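/- Let $X_1,X_2$ be independent, identically distributed, non-negative, integrable real random variables with common law $\mu$, distribution function $F(x)=\mathbb P(X\le x)$, $x\in[-\infty,\infty]$, and density $f\ge 0$. Let $\mathcal X$ be the (closed) support of $\mu$, and assume that $f$ is differentiable in the interior of $\mathcal X$. For $i=1,2$ let $\inf\mathcal X=\ell_{i,0}\le\ell_{i,1}\le\dots\le\ell_{i,K}=\sup\mathcal X\le\infty$ be the decision boundaries of a scalar quantizer with cells $\mathcal L_{i,k}=\{x\in\mathbb R:\ell_{i,k-1}\le x\le\ell_{i,k}\}$, $\mathcal X=\bigcup_{k=1}^K\mathcal L_{i,k}$, and let $U_i\in\{1,\dots,K\}$ be a random variable with $X_i\in\mathcal L_{i,U_i}$ almost surely. Let $Z_M=\max(X_1,X_2)$ and let $$d_M((x_1,x_2),\hat z)=\begin{cases}\max(x_1,x_2)-\hat z&\text{if }\hat z\le\max(x_1,x_2),\\ \max(x_1,x_2)&\text{otherwise.}\end{cases}$$ For a pair $(k_1,k_2)$ with $\mathbb P(U_1=k_1,U_2=k_2)>0$, a Bayes estimate is a real $z$ that minimizes $\mathbb E[d_M((X_1,X_2),z)\mid U_1=k_1,U_2=k_2]$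 over $\mathbb R$. For a pair $(k_1,k_2)$ write $a_i=\ell_{i,k_i-1}$, $b_i=\ell_{i,k_i}$, $m=\max(a_1,a_2)$, and let $F_i(z)=\mathbb P(X_i\le z\mid X_i\in\mathcal L_{i,k_i})$ be the conditional distribution functions. Put $$\mathbf Z_1=\{b_2\le a_1\},\quad \mathbf Z_2=\{b_1\le a_2\},\quad \mathbf Z_{01}=\{m<b_2\le b_1\},\quad \mathbf Z_{02}=\{m<b_1<b_2\},$$ $$w_{11}(z)=w_{21}(z)=z[1-F_1(z)F_2(z)],\qquad w_{12}(z)=z[1-F_1(z)],\qquad w_{22}(z)=z[1-F_2(z)].$$ For a set $S\subset\mathbb R$, a boundary value $a$ and an objective $w$, call $z$ a *best element* of $S\cup\{a\}$ for $w$ if $z\in S\cup\{a\}$ and $w(y)\le w(z)$ for all $y\in S\cup\{a\}$ (so $z=a$ if $S=\emptyset$; if $a=+\infty$, the boundary value is replaced by $0$). For the pairs in the region named in brackets, consider values such that * [$\mathbf Z_1$] $\hat z_1^*$ is a best element of $\{z\in\mathcal L_{1,k_1}:F(b_1)=F(z)+zf(z),\ 2f(z)+zf'(z)\ge0\}\cup\{a_1\}$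 for $w_{12}$; * [$\mathbf Z_2$] $\hat z_2^*$ is a best element of $\{z\in\mathcal L_{2,k_2}:F(b_2)=F(z)+zf(z),\ 2f(z)+zf'(z)\ge0\}\cup\{a_2\}$ for $w_{22}$; * [$\mathbf Z_{01}$] $\hat z_{11}^*$ is a best element of $\{z\in[m,b_2]:w_{11}'(z)=0,\ w_{11}''(z)\le0\}\cup\{m\}$ for $w_{11}$, and $\hat z_{12}^*$ is a best element of $\{z\in[b_2,b_1]:F(b_1)=F(z)+zf(z),\ 2f(z)+zf'(z)\ge0\}\cup\{b_2\}$ for $w_{12}$; * [$\mathbf Z_{02}$] $\hat z_{21}^*$ is a best element of $\{z\in[m,b_1]:w_{21}'(z)=0,\ w_{21}''(z)\le0\}\cup\{m\}$ for $w_{21}$, and $\hat z_{22}^*$ is a best element of $\{z\in[b_1,b_2]:F(b_2)=F(z)+zf(z),\ 2f(z)+zf'(z)\ge0\}\cup\{b_1\}$ for $w_{22}$. Here the intervals are sets of real numbers, and derivatives of $w_{11}$, $w_{21}$ are taken within the interval named (one-sided at its end points); where a derivative does not exist, its value is taken to be $0$ (this can happen at end points of intervals only). Let $$\hat z(k_1,k_2)=\begin{cases}\hat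 z_1^*&(k_1,k_2)\in\mathbf Z_1,\\ \hat z_2^*&(k_1,k_2)\in\mathbf Z_2,\\ \hat z_{01}^*&(k_1,k_2)\in\mathbf Z_{01},\\ \hat z_{02}^*&(k_1,k_2)\in\mathbf Z_{02},\end{cases}\qquad \hat z_{0i}^*=\begin{cases}\hat z_{i1}^*&w_{i1}(\hat z_{i1}^*)\ge w_{i2}(\hat z_{i2}^*),\\ \hat z_{i2}^*&\text{otherwise}\end{cases}$$ (the first applicable case counts; a pair in no region has probability $0$, and $\hat z=0$ there). Then: 1. For every pair $(k_1,k_2)$ of positive probability, $z$ is a Bayes estimate if and only if it maximizes $z\,\mathbb P(Z_M\ge z\mid X_1\in\mathcal L_{1,k_1},X_2\in\mathcal L_{2,k_2})$ over $\mathbb R$. 2. Values $\hat z_1^*,\hat z_2^*,\hat z_{11}^*,\hat z_{12}^*,\hat z_{21}^*,\hat z_{22}^*$ as above exist. 3. For every choice of such values, $\hat z(k_1,k_2)$ is a Bayes estimate for every pair of positive probability, $\hat z(U_1,U_2)$ has the least expected distortion among all estimators $g(U_1,U_2)$, the distortion $d_M((X_1,X_2),\hat z(U_1,U_2))$ is integrable,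 and $$\begin{aligned}D(\ell)&=\mathbb E[d_M((X_1,X_2),\hat z(U_1,U_2))]\\ &=\sum_{\mathbf Z_1}\Big[\int_{a_1}^{b_1}xf(x)\,dx-\hat z_1^*[F(b_1)-F(\hat z_1^*)]\Big][F(b_2)-F(a_2)]\\ &+\sum_{\mathbf Z_2}\Big[\int_{a_2}^{b_2}xf(x)\,dx-\hat z_2^*[F(b_2)-F(\hat z_2^*)]\Big][F(b_1)-F(a_1)]\\ &+\sum_{\mathbf Z_{01}}\int_{m}^{b_2}zf(z)[2F(z)-F(a_2)-F(a_1)]\,dz+\sum_{\mathbf Z_{01}}\int_{b_2}^{b_1}zf(z)[F(b_2)-F(a_2)]\,dz\\ &-\sum_{\mathbf Z_{01}}\max\{w_{11}(\hat z_{11}^*),w_{12}(\hat z_{12}^*)\}[F(b_1)-F(a_1)][F(b_2)-F(a_2)]\\ &+\sum_{\mathbf Z_{02}}\int_{m}^{b_1}zf(z)[2F(z)-F(a_1)-F(a_2)]\,dz+\sum_{\mathbf Z_{02}}\int_{b_1}^{b_2}zf(z)[F(b_1)-F(a_1)]\,dz\\ &-\sum_{\mathbf Z_{02}}\max\{w_{21}(\hat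 z_{21}^*),w_{22}(\hat z_{22}^*)\}[F(b_1)-F(a_1)][F(b_2)-F(a_2)].\end{aligned}$$ 4. Conversely, for a pair of positive probability every Bayes estimate satisfies the condition on $\hat z_1^*$ if the pair is in $\mathbf Z_1$, the one on $\hat z_2^*$ if it is in $\mathbf Z_2$, the one on $\hat z_{11}^*$ or the one on $\hat z_{12}^*$ if it is in $\mathbf Z_{01}$, and the one on $\hat z_{21}^*$ or the one on $\hat z_{22}^*$ if it is in $\mathbf Z_{02}$. -/

import Mathlib

open MeasureTheory ProbabilityTheory Set

noncomputable section

namespace MaxHetSQ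

/-- The max distortion `d_M` for two users: linear loss for under-estimation of the maximum,
and loss of the whole maximum for over-estimation. -/
def dM (x₁ x₂ zhat : ℝ) : ℝ :=
  if zhat ≤ max x₁ x₂ then max x₁ x₂ - zhat else max x₁ x₂

/-- The quantization cell `[a, b]`; its end points are extended reals, so that the last cell may be
unbounded. -/
def cell (a b : EReal) : Set ℝ := {x | a ≤ (x : EReal) ∧ (x : EReal) ≤ b}

/-- `ℓ 0 ≤ ℓ 1 ≤ … ≤ ℓ K` are the decision boundaries of a scalar quantizer with `K` cells
`[ℓ (k-1), ℓ k]` for a source with support `S`. The `K` cells are indexed by `k : Fin K`, the lower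
and upper end points of the cell being `ℓ k.castSucc` and `ℓ k.succ`. -/
structure IsQuantizer {K : ℕ} (S : Set ℝ) (ℓ : Fin (K + 1) → EReal) : Prop where
  mono : Monotone ℓ
  first : ℓ 0 = sInf (Real.toEReal '' S)
  last : ℓ (Fin.last K) = sSup (Real.toEReal '' S)
  cover : S = ⋃ k : Fin K, cell (ℓ k.castSucc) (ℓ k.succ)

/-- The distribution function of the law `μ` on the extended real line. -/
def F (μ : Measure ℝ) (x : EReal) : ℝ := μ.real {y : ℝ | (y : EReal) ≤ x}

/-- The conditional distribution function of `X` given `X ∈ [a, b]`, for `X` with law `μ`. -/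
def Fcond (μ : Measure ℝ) (a b : EReal) (z : ℝ) : ℝ := (cond μ (cell a b)).real (Iic z)

/-- `w₁₁ = w₂₁ : z ↦ z [1 - F_{X ∣ X ∈ [a₁, b₁]}(z) F_{X ∣ X ∈ [a₂, b₂]}(z)]`. -/
def wBoth (μ : Measure ℝ) (a₁ b₁ a₂ b₂ : EReal) (z : ℝ) : ℝ :=
  z * (1 - Fcond μ a₁ b₁ z * Fcond μ a₂ b₂ z)

/-- `w₁₂` (for the cell of user 1) and `w₂₂` (for the cell of user 2):
`z ↦ z [1 - F_{X ∣ X ∈ [a, b]}(z)]`. -/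
def wOne (μ : Measure ℝ) (a b : EReal) (z : ℝ) : ℝ :=
  z * (1 - Fcond μ a b z)

/-- The solutions `z` in `[a, b]` of `F(b) = F(z) + z f(z)` and `2 f(z) + z f'(z) ≥ 0`. -/
def solOne (μ : Measure ℝ) (f : ℝ → ℝ) (a b : EReal) : Set ℝ :=
  {z | z ∈ cell a b ∧ F μ b = F μ z + z * f z ∧ 0 ≤ 2 * f z + z * deriv f z}

/-- The solutions `z` in `[a, b]` of `w'(z) = 0` and `w''(z) ≤ 0`; the derivatives are taken within
`[a, b]`, hence are one-sided at the end points. -/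
def solBoth (w : ℝ → ℝ) (a b : EReal) : Set ℝ :=
  {z | z ∈ cell a b ∧ derivWithin w (cell a b) z = 0 ∧
    derivWithin (derivWithin w (cell a b)) (cell a b) z ≤ 0}

/-- `z` is a solution in `S` or the boundary value `a`, and is the best of all of these for the
objective `w`. In particular `z = a` if `S` is empty. For `a = ⊤` (then the interval that starts at
`a` contains no real number) the boundary value is replaced by `0`, where all the objectives used
below take their limit `0` at `+∞`. -/
def IsBest (w : ℝ → ℝ) (S : Set ℝ) (a : EReal) (z : ℝ) : Prop :=
  z ∈ S ∪ {a.toReal} ∧ ∀ y ∈ S ∪ {a.toReal}, w y ≤ w z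

/-- The condition on `ẑ₁*` (cell `[a, b]` of user 1) and on `ẑ₂*` (cell `[a, b]` of user 2). -/
def IsZ1 (μ : Measure ℝ) (f : ℝ → ℝ) (a b : EReal) (z : ℝ) : Prop :=
  IsBest (wOne μ a b) (solOne μ f a b) a z

/-- The condition on `ẑ₁₁*`, for `[a₁, b₁]` the cell of user 1 and `[a₂, b₂]` the one of user 2,
`b₂ ≤ b₁`; and the condition on `ẑ₂₁*` if the two users are exchanged. -/
def IsZ11 (μ : Measure ℝ) (a₁ b₁ a₂ b₂ : EReal) (z : ℝ) : Prop :=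
  IsBest (wBoth μ a₁ b₁ a₂ b₂) (solBoth (wBoth μ a₁ b₁ a₂ b₂) (max a₁ a₂) b₂) (max a₁ a₂) z

/-- The condition on `ẑ₁₂*`, for `[a₁, b₁]` the cell of user 1 and `b₂ ≤ b₁` the upper end point of
the cell of user 2; and the condition on `ẑ₂₂*` if the two users are exchanged. -/
def IsZ12 (μ : Measure ℝ) (f : ℝ → ℝ) (a₁ b₁ b₂ : EReal) (z : ℝ) : Prop :=
  IsBest (wOne μ a₁ b₁) (solOne μ f b₂ b₁) b₂ z

section Regions

variable {K : ℕ} (ℓ₁ ℓ₂ : Fin (K + 1) → EReal)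

/-- The region where `X₁` is the maximum. -/
def Z1 : Finset (Fin K × Fin K) :=
  Finset.univ.filter fun k => ℓ₂ k.2.succ ≤ ℓ₁ k.1.castSucc

/-- The region where `X₂` is the maximum. -/
def Z2 : Finset (Fin K × Fin K) :=
  Finset.univ.filter fun k => ℓ₁ k.1.succ ≤ ℓ₂ k.2.castSucc

/-- The cells overlap, and the one of user 2 ends first (or both end together). -/
def Z01 : Finset (Fin K × Fin K) :=
  Finset.univ.filter fun k =>
    max (ℓ₁ k.1.castSucc) (ℓ₂ k.2.castSucc) < ℓ₂ k.2.succ ∧ ℓ₂ k.2.succ ≤ ℓ₁ k.1.succ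

/-- The cells overlap, and the one of user 1 ends first. -/
def Z02 : Finset (Fin K × Fin K) :=
  Finset.univ.filter fun k =>
    max (ℓ₁ k.1.castSucc) (ℓ₂ k.2.castSucc) < ℓ₁ k.1.succ ∧ ℓ₁ k.1.succ < ℓ₂ k.2.succ

end Regions

/-- The values `ẑ₁*, ẑ₂*, ẑ₁₁*, ẑ₁₂*, ẑ₂₁*, ẑ₂₂*` for each pair of quantization indices. -/
structure Candidates (K : ℕ) where
  z1 : Fin K × Fin K → ℝ
  z2 : Fin K × Fin K → ℝ
  z11 : Fin K × Fin K → ℝ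
  z12 : Fin K × Fin K → ℝ
  z21 : Fin K × Fin K → ℝ
  z22 : Fin K × Fin K → ℝ

section Estimator

variable {K : ℕ} (μ : Measure ℝ) (f : ℝ → ℝ) (ℓ₁ ℓ₂ : Fin (K + 1) → EReal)

/-- `w₁₁ = w₂₁` for the pair of cells with indices `k`. -/
def w11 (k : Fin K × Fin K) : ℝ → ℝ :=
  wBoth μ (ℓ₁ k.1.castSucc) (ℓ₁ k.1.succ) (ℓ₂ k.2.castSucc) (ℓ₂ k.2.succ)

/-- `w₁₂` for the pair of cells with indices `k`. -/
def w12 (k : Fin K × Fin K) : ℝ → ℝ := wOne μ (ℓ₁ k.1.castSucc) (ℓ₁ k.1.succ)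

/-- `w₂₂` for the pair of cells with indices `k`. -/
def w22 (k : Fin K × Fin K) : ℝ → ℝ := wOne μ (ℓ₂ k.2.castSucc) (ℓ₂ k.2.succ)

/-- The values in `c` satisfy the conditions that determine them, in the regions where they are
used. -/
structure Candidates.Valid (c : Candidates K) : Prop where
  z1 : ∀ k ∈ Z1 ℓ₁ ℓ₂, IsZ1 μ f (ℓ₁ k.1.castSucc) (ℓ₁ k.1.succ) (c.z1 k)
  z2 : ∀ k ∈ Z2 ℓ₁ ℓ₂, IsZ1 μ f (ℓ₂ k.2.castSucc) (ℓ₂ k.2.succ) (c.z2 k)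
  z11 : ∀ k ∈ Z01 ℓ₁ ℓ₂, IsZ11 μ (ℓ₁ k.1.castSucc) (ℓ₁ k.1.succ)
    (ℓ₂ k.2.castSucc) (ℓ₂ k.2.succ) (c.z11 k)
  z12 : ∀ k ∈ Z01 ℓ₁ ℓ₂, IsZ12 μ f (ℓ₁ k.1.castSucc) (ℓ₁ k.1.succ) (ℓ₂ k.2.succ) (c.z12 k)
  z21 : ∀ k ∈ Z02 ℓ₁ ℓ₂, IsZ11 μ (ℓ₂ k.2.castSucc) (ℓ₂ k.2.succ)
    (ℓ₁ k.1.castSucc) (ℓ₁ k.1.succ) (c.z21 k)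
  z22 : ∀ k ∈ Z02 ℓ₁ ℓ₂, IsZ12 μ f (ℓ₂ k.2.castSucc) (ℓ₂ k.2.succ) (ℓ₁ k.1.succ) (c.z22 k)

open Classical in
/-- The estimator `ẑ(U₁, U₂)`, region by region. A pair of cells that is in none of the four regions
has a cell with equal end points, so has probability `0`. -/
def Candidates.estimate (c : Candidates K) (k : Fin K × Fin K) : ℝ :=
  if k ∈ Z1 ℓ₁ ℓ₂ then c.z1 k
  else if k ∈ Z2 ℓ₁ ℓ₂ then c.z2 k
  else if k ∈ Z01 ℓ₁ ℓ₂ then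
    if w12 μ ℓ₁ k (c.z12 k) ≤ w11 μ ℓ₁ ℓ₂ k (c.z11 k) then c.z11 k else c.z12 k
  else if k ∈ Z02 ℓ₁ ℓ₂ then
    if w22 μ ℓ₂ k (c.z22 k) ≤ w11 μ ℓ₁ ℓ₂ k (c.z21 k) then c.z21 k else c.z22 k
  else 0

/-- The explicit expression for the expected distortion `D(ℓ)`. -/
def Dformula (c : Candidates K) : ℝ :=
  (∑ k ∈ Z1 ℓ₁ ℓ₂,
      ((∫ x in cell (ℓ₁ k.1.castSucc) (ℓ₁ k.1.succ), x * f x)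
        - c.z1 k * (F μ (ℓ₁ k.1.succ) - F μ (c.z1 k)))
      * (F μ (ℓ₂ k.2.succ) - F μ (ℓ₂ k.2.castSucc)))
  + (∑ k ∈ Z2 ℓ₁ ℓ₂,
      ((∫ x in cell (ℓ₂ k.2.castSucc) (ℓ₂ k.2.succ), x * f x)
        - c.z2 k * (F μ (ℓ₂ k.2.succ) - F μ (c.z2 k)))
      * (F μ (ℓ₁ k.1.succ) - F μ (ℓ₁ k.1.castSucc)))
  + (∑ k ∈ Z01 ℓ₁ ℓ₂,
      ∫ z in cell (max (ℓ₁ k.1.castSucc) (ℓ₂ k.2.castSucc)) (ℓ₂ k.2.succ),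
        z * f z * (2 * F μ z - F μ (ℓ₂ k.2.castSucc) - F μ (ℓ₁ k.1.castSucc)))
  + (∑ k ∈ Z01 ℓ₁ ℓ₂,
      ∫ z in cell (ℓ₂ k.2.succ) (ℓ₁ k.1.succ),
        z * f z * (F μ (ℓ₂ k.2.succ) - F μ (ℓ₂ k.2.castSucc)))
  - (∑ k ∈ Z01 ℓ₁ ℓ₂,
      max (w11 μ ℓ₁ ℓ₂ k (c.z11 k)) (w12 μ ℓ₁ k (c.z12 k))
        * (F μ (ℓ₁ k.1.succ) - F μ (ℓ₁ k.1.castSucc))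
        * (F μ (ℓ₂ k.2.succ) - F μ (ℓ₂ k.2.castSucc)))
  + (∑ k ∈ Z02 ℓ₁ ℓ₂,
      ∫ z in cell (max (ℓ₁ k.1.castSucc) (ℓ₂ k.2.castSucc)) (ℓ₁ k.1.succ),
        z * f z * (2 * F μ z - F μ (ℓ₁ k.1.castSucc) - F μ (ℓ₂ k.2.castSucc)))
  + (∑ k ∈ Z02 ℓ₁ ℓ₂,
      ∫ z in cell (ℓ₁ k.1.succ) (ℓ₂ k.2.succ),
        z * f z * (F μ (ℓ₁ k.1.succ) - F μ (ℓ₁ k.1.castSucc)))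
  - (∑ k ∈ Z02 ℓ₁ ℓ₂,
      max (w11 μ ℓ₁ ℓ₂ k (c.z21 k)) (w22 μ ℓ₂ k (c.z22 k))
        * (F μ (ℓ₁ k.1.succ) - F μ (ℓ₁ k.1.castSucc))
        * (F μ (ℓ₂ k.2.succ) - F μ (ℓ₂ k.2.castSucc)))

end Estimator

section Bayes

variable {Ω : Type*} [MeasurableSpace Ω] (P : Measure Ω) (X₁ X₂ : Ω → ℝ)

/-- `E[d_M((X₁, X₂), z) ∣ (U₁, U₂) = k]`. -/
def condDistortion {K : ℕ} (U₁ U₂ : Ω → Fin K) (k : Fin K × Fin K) (z : ℝ) : ℝ :=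
  ∫ ω, dM (X₁ ω) (X₂ ω) z ∂(cond P {ω | U₁ ω = k.1 ∧ U₂ ω = k.2})

/-- `z` is a Bayes estimate of the maximum given `(U₁, U₂) = k`: it minimizes the conditional
expected distortion. -/
def IsBayes {K : ℕ} (U₁ U₂ : Ω → Fin K) (k : Fin K × Fin K) (z : ℝ) : Prop :=
  ∀ y : ℝ, condDistortion P X₁ X₂ U₁ U₂ k z ≤ condDistortion P X₁ X₂ U₁ U₂ k y

/-- `z · P(max(X₁, X₂) ≥ z ∣ X₁ ∈ L₁, X₂ ∈ L₂)`. -/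
def gain (L₁ L₂ : Set ℝ) (z : ℝ) : ℝ :=
  z * (cond P {ω | X₁ ω ∈ L₁ ∧ X₂ ω ∈ L₂}).real {ω | z ≤ max (X₁ ω) (X₂ ω)}

/-- The expected distortion `E[d_M((X₁, X₂), g(U₁, U₂))]` of the estimator `g`. -/
def distortion {K : ℕ} (U₁ U₂ : Ω → Fin K) (g : Fin K × Fin K → ℝ) : ℝ :=
  ∫ ω, dM (X₁ ω) (X₂ ω) (g (U₁ ω, U₂ ω)) ∂P

end Bayes

end MaxHetSQ

end

open MaxHetSQ

namespace MaxHetSQ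

open Filter Topology

/-! The distortion is the maximum minus a reward `z`, earned exactly when `z` does not exceed the
maximum. Given the two cells, the expected distortion is therefore a constant minus `gain`, and
Bayes estimates are the maximizers of `gain`. The law has a density, hence no atoms; with
independence this turns `gain` into the single function `wBoth`, `z (1 - F₁ F₂)`, on the whole real
line (`gain_eq_wBoth`).

Everything then rests on the shape of `wBoth` when `b₂ ≤ b₁`. It equals `z` up to `m`, equals `wOne`
from `b₂` on because `F₂ = 1` there, and vanishes from `b₁` on. It is continuous and, by
integrability, tends to `0` at infinity, so it has a maximizer, which lies in `[m, b₁)`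
(`mem_of_forall_wBoth_le`). Away from `m` and `b₂` a maximizer satisfies the first and second order
conditions, so it is itself among the listed candidates. Every candidate value is a value of
`wBoth`; hence the better of the two best elements attains the global maximum (`wBoth_le_max`), and
conversely each maximizer is a best element of one of the two lists. The separated regions are the
case `b₂ ≤ a₁`, and the regions of user 2 follow by exchanging the users.

Best elements need not exist for an arbitrary infinite list, and the lists need not be closed, as
`f'` may be discontinuous. But a limit of zeros of a differentiable slope is on the list already or
is a zero of both the slope and its derivative, hence satisfies the weak second order condition
(`mem_or_deriv_eq_zero_of_mem_closure`, `exists_isBest`).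

The cells cover the support, so the support fills the interval between its extreme points;
nondegenerate cells thus have positive mass and `f` is differentiable inside this interval
(`IsQuantizer.isSource`). The formula for `D` sums over pairs of indices, with the expected maximum
computed by Fubini (`setIntegral_max`). -/

theorem measurableSet_cell (a b : EReal) : MeasurableSet (cell a b) :=
  (measurableSet_le measurable_const measurable_coe_real_ereal).inter
    (measurableSet_le measurable_coe_real_ereal measurable_const)

theorem cell_inter_Iic (a b : EReal) (z : ℝ) : cell a b ∩ Iic z = cell a (min b z) := by
  ext x
  simp [cell, and_assoc]

/-! ### Conditional distribution functions and objectives: continuity and decay. -/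

section Law

variable {μ : Measure ℝ}

theorem measure_coe_eq [NullSingletonClass μ] (a : EReal) : μ {y : ℝ | (y : EReal) = a} = 0 := by
  refine Set.Subsingleton.measure_zero (fun x hx y hy => ?_) μ
  exact EReal.coe_injective (Eq.trans hx (Eq.symm hy))

theorem cell_self_null [NullSingletonClass μ] (a b : EReal) (h : b ≤ a) : μ (cell a b) = 0 :=
  measure_mono_null (fun _ hx => le_antisymm (hx.2.trans h) hx.1) (measure_coe_eq (μ := μ) a)

variable [IsProbabilityMeasure μ] [NullSingletonClass μ]

omit [NullSingletonClass μ] in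
theorem F_mono {a b : EReal} (h : a ≤ b) : F μ a ≤ F μ b :=
  measureReal_mono fun _ hx => le_trans hx h

/-- Without atoms it does not matter that a closed cell also contains its lower end point. -/
theorem real_cell {a b : EReal} (h : a ≤ b) : μ.real (cell a b) = F μ b - F μ a := by
  have h1 : {y : ℝ | (y : EReal) ≤ b} =ᵐ[μ] ({y : ℝ | (y : EReal) ≤ a} ∪ cell a b : Set ℝ) := by
    refine Eventually.of_forall fun x => propext ⟨fun hx => ?_, ?_⟩
    · exact (le_total (x : EReal) a).imp id fun h => ⟨h, hx⟩
    · rintro (hx | hx)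
      exacts [le_trans hx h, hx.2]
  have h2 : AEDisjoint μ {y : ℝ | (y : EReal) ≤ a} (cell a b) :=
    measure_mono_null (fun x hx => le_antisymm hx.1 hx.2.1) (measure_coe_eq (μ := μ) a)
  rw [F, measureReal_congr h1, measureReal_union₀ (measurableSet_cell a b).nullMeasurableSet h2, F]
  ring

theorem real_cell_inter_Iic {a b : EReal} {z : ℝ} (hab : a ≤ b) (haz : a ≤ z) :
    μ.real (cell a b ∩ Iic z) = F μ (min b z) - F μ a := by
  rw [cell_inter_Iic, real_cell (le_min hab haz)]

omit [IsProbabilityMeasure μ] in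
theorem real_cell_inter_Iic_of_le {a : EReal} (b : EReal) {z : ℝ} (hza : z ≤ a) :
    μ.real (cell a b ∩ Iic z) = 0 := by
  rw [cell_inter_Iic, Measure.real, cell_self_null _ _ ((min_le_right _ _).trans hza)]
  rfl

omit [IsProbabilityMeasure μ] [NullSingletonClass μ] in
theorem Fcond_eq_inv_mul (a b : EReal) (z : ℝ) :
    Fcond μ a b z = (μ.real (cell a b))⁻¹ * μ.real (cell a b ∩ Iic z) := by
  simp only [Fcond, Measure.real, cond_apply (measurableSet_cell a b), ENNReal.toReal_mul,
    ENNReal.toReal_inv]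

omit [IsProbabilityMeasure μ] in
theorem Fcond_of_le {a b : EReal} {z : ℝ} (hza : z ≤ a) : Fcond μ a b z = 0 := by
  rw [Fcond_eq_inv_mul, real_cell_inter_Iic_of_le b hza, mul_zero]

omit [IsProbabilityMeasure μ] [NullSingletonClass μ] in
theorem Fcond_of_ge {a b : EReal} {z : ℝ} (hbz : b ≤ z) (hpos : 0 < μ.real (cell a b)) :
    Fcond μ a b z = 1 := by
  rw [Fcond_eq_inv_mul, cell_inter_Iic, min_eq_left hbz, inv_mul_cancel₀ hpos.ne']

theorem Fcond_eq_div {a b : EReal} {z : ℝ} (haz : a ≤ z) (hzb : z ≤ b) :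
    Fcond μ a b z = (F μ z - F μ a) / (F μ b - F μ a) := by
  rw [Fcond_eq_inv_mul, real_cell_inter_Iic (haz.trans hzb) haz, min_eq_right hzb,
    real_cell (haz.trans hzb), div_eq_inv_mul]

omit [IsProbabilityMeasure μ] [NullSingletonClass μ] in
theorem Fcond_nonneg (a b : EReal) (z : ℝ) : 0 ≤ Fcond μ a b z := measureReal_nonneg

omit [NullSingletonClass μ] [IsProbabilityMeasure μ] in
theorem Fcond_le_one (a b : EReal) (z : ℝ) : Fcond μ a b z ≤ 1 := by
  rw [Fcond]
  exact measureReal_le_one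

theorem Fcond_lt_one {a b : EReal} {z : ℝ} (hpos : 0 < μ.real (cell (max a z) b)) :
    Fcond μ a b z < 1 := by
  have hlt : max a z < b := by
    by_contra! h
    rw [Measure.real, cell_self_null _ _ h] at hpos
    exact lt_irrefl _ hpos
  rcases le_total a z with h | h
  · rw [max_eq_right h] at hpos hlt
    have h1 := real_cell (μ := μ) hlt.le
    have h2 := F_mono (μ := μ) h
    rw [Fcond_eq_div h hlt.le, div_lt_one (by linarith)]
    linarith
  · rw [Fcond_of_le h]
    exact one_pos

omit [NullSingletonClass μ] in
theorem isProbabilityMeasure_cond_cell {a b : EReal} (hpos : 0 < μ.real (cell a b)) :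
    IsProbabilityMeasure (ProbabilityTheory.cond μ (cell a b)) := by
  refine cond_isProbabilityMeasure fun h => ?_
  rw [Measure.real, h] at hpos
  exact lt_irrefl _ hpos

theorem continuous_Fcond (a b : EReal) : Continuous (Fcond μ a b) := by
  -- Written as a primitive of the constant `1` against an atomless measure, the function is visibly
  -- continuous.
  have h : Fcond μ a b = fun z => (μ.real (cell a b))⁻¹ *
      ((∫ _ in Iic (0 : ℝ), (1 : ℝ) ∂μ.restrict (cell a b)) +
        ∫ _ in (0 : ℝ)..z, (1 : ℝ) ∂μ.restrict (cell a b)) := by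
    funext z
    rw [← intervalIntegral.integral_Iic_sub_Iic (integrable_const _).integrableOn
      (integrable_const _).integrableOn, add_sub_cancel, Fcond_eq_inv_mul]
    simp [inter_comm]
  rw [h]
  exact continuous_const.mul (continuous_const.add
    (intervalIntegral.continuous_primitive (fun _ _ => intervalIntegrable_const) 0))

-- Markov's inequality in tail form: `z ν(Ioi z)` is at most the integral of `x` over `Ioi z`, which
-- tends to `0` because the mean is finite.
omit [NullSingletonClass μ] in
theorem tendsto_wOne (hint : Integrable id μ) {a b : EReal} (hpos : 0 < μ.real (cell a b)) :
    Tendsto (wOne μ a b) atTop (𝓝 0) := by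
  have := isProbabilityMeasure_cond_cell hpos
  set ν := ProbabilityTheory.cond μ (cell a b) with hν
  have hi : Integrable id ν := by
    rw [hν, ProbabilityTheory.cond]
    exact (hint.restrict).smul_measure (by
      rw [Ne, ENNReal.inv_eq_top]
      intro h
      rw [Measure.real, h] at hpos
      exact lt_irrefl _ hpos)
  have hlim : Tendsto (fun z : ℝ => ∫ x in Ioi z, id x ∂ν) atTop (𝓝 0) :=
    tendsto_integral_Ioi_zero tendsto_id
  refine tendsto_of_tendsto_of_tendsto_of_le_of_le' tendsto_const_nhds hlim ?_ ?_
  · filter_upwards [eventually_ge_atTop 0] with z hz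
    exact mul_nonneg hz (sub_nonneg.2 (Fcond_le_one _ _ _))
  · filter_upwards [eventually_ge_atTop 0] with z hz
    have h1 : 1 - Fcond μ a b z = ν.real (Ioi z) := by
      rw [Fcond, ← hν, ← probReal_compl_eq_one_sub measurableSet_Iic, compl_Iic]
    have h2 : z * ν.real (Ioi z) = ∫ _ in Ioi z, z ∂ν := by simp [mul_comm]
    rw [wOne, h1, h2]
    exact setIntegral_mono_on integrableOn_const hi.integrableOn measurableSet_Ioi
      fun x hx => le_of_lt hx

theorem continuous_wOne (a b : EReal) : Continuous (wOne μ a b) :=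
  continuous_id.mul (continuous_const.sub (continuous_Fcond a b))

theorem continuous_wBoth (a₁ b₁ a₂ b₂ : EReal) : Continuous (wBoth μ a₁ b₁ a₂ b₂) :=
  continuous_id.mul (continuous_const.sub ((continuous_Fcond _ _).mul (continuous_Fcond _ _)))

omit [NullSingletonClass μ] in
theorem tendsto_wBoth (hint : Integrable id μ) {a₁ b₁ a₂ b₂ : EReal}
    (hpos₁ : 0 < μ.real (cell a₁ b₁)) (hpos₂ : 0 < μ.real (cell a₂ b₂)) :
    Tendsto (wBoth μ a₁ b₁ a₂ b₂) atTop (𝓝 0) := by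
  -- This is the identity `1 - F₁ F₂ = (1 - F₁) + F₁ (1 - F₂)`.
  have h : wBoth μ a₁ b₁ a₂ b₂ =
      fun z => wOne μ a₁ b₁ z + Fcond μ a₁ b₁ z * wOne μ a₂ b₂ z := by
    funext z
    simp only [wBoth, wOne]
    ring
  rw [h, show (0 : ℝ) = 0 + 0 by ring]
  refine (tendsto_wOne hint hpos₁).add ?_
  refine bdd_le_mul_tendsto_zero' 1 (Eventually.of_forall fun z => ?_) (tendsto_wOne hint hpos₂)
  rw [abs_of_nonneg (Fcond_nonneg _ _ _)]
  exact Fcond_le_one _ _ _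

omit [IsProbabilityMeasure μ] [NullSingletonClass μ] in
theorem wBoth_comm (a₁ b₁ a₂ b₂ : EReal) : wBoth μ a₁ b₁ a₂ b₂ = wBoth μ a₂ b₂ a₁ b₁ := by
  funext z
  rw [wBoth, wBoth, mul_comm (Fcond μ a₁ b₁ z)]

end Law

/-! ### Necessary conditions for maxima, and existence of best elements. -/

section Calculus

/-- A limit point of zeros of `g` is a zero of `g` and, if `g` is differentiable there, of `g'`. -/
theorem mem_or_deriv_eq_zero_of_mem_closure {S : Set ℝ} {g : ℝ → ℝ} {y : ℝ}
    (hg : DifferentiableAt ℝ g y) (hS : ∀ᶠ z in 𝓝 y, z ∈ S → g z = 0) (hy : y ∈ closure S) :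
    y ∈ S ∨ (g y = 0 ∧ deriv g y = 0) := by
  by_cases hyS : y ∈ S
  · exact Or.inl hyS
  refine Or.inr ?_
  -- Since `y` is not in `S`, the points of `S` that approach it differ from it. A nonzero value or
  -- a nonzero derivative of `g` at `y` would exclude such zeros nearby.
  have hfr : ∃ᶠ z in 𝓝[≠] y, g z = 0 := by
    have h1 : ∃ᶠ z in 𝓝 y, z ∈ S := mem_closure_iff_frequently.1 hy
    have h2 : ∃ᶠ z in 𝓝 y, z ≠ y ∧ g z = 0 :=
      (h1.and_eventually hS).mono fun z hz => ⟨fun h => hyS (h ▸ hz.1), hz.2 hz.1⟩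
    rw [frequently_nhdsWithin_iff]
    exact h2.mono fun z hz => ⟨hz.2, hz.1⟩
  constructor
  · by_contra h
    have h3 : ∀ᶠ z in 𝓝[≠] y, g z ≠ 0 :=
      (hg.continuousAt.eventually_ne h).filter_mono nhdsWithin_le_nhds
    exact hfr h3
  · by_contra h
    exact hfr (hg.hasDerivAt.eventually_ne h)

/-- First and second order necessary conditions for an interior maximum. -/
theorem deriv_nonpos_of_isLocalMax {w g : ℝ → ℝ} {z : ℝ} (hz : IsLocalMax w z)
    (hw : ∀ᶠ y in 𝓝 z, HasDerivAt w (g y) y) : g z = 0 ∧ deriv g z ≤ 0 := by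
  have h0 : g z = 0 := hz.hasDerivAt_eq_zero hw.self_of_nhds
  refine ⟨h0, ?_⟩
  by_contra! hpos
  have hd : deriv w =ᶠ[𝓝 z] g := hw.mono fun y hy => hy.deriv
  -- If `w'' > 0`, the second derivative test makes `z` a local minimum as well; then `w` is locally
  -- constant and `w'' = 0`, a contradiction.
  have hmin : IsLocalMin w z := isLocalMin_of_deriv_deriv_pos (by rwa [hd.deriv_eq])
    (by rw [hd.self_of_nhds, h0]) hw.self_of_nhds.continuousAt
  have hc : w =ᶠ[𝓝 z] fun _ => w z := by
    filter_upwards [hz, hmin] with y h1 h2 using le_antisymm h1 h2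
  have hd2 : deriv w =ᶠ[𝓝 z] fun _ => 0 := by
    filter_upwards [hc.eventuallyEq_nhds] with y hy
    rw [hy.deriv_eq, deriv_const]
  have h3 : deriv g z = 0 := by
    rw [← hd.deriv_eq, hd2.deriv_eq, deriv_const]
  exact hpos.ne' h3

/-- If no candidate has positive value, the boundary value is already best. Otherwise fix a
candidate `t` with `w t > 0`: the candidates at least as good as `t` form a compact set, bounded
because `w` tends to `0`. Closedness is needed only where `w > 0`; this leaves out the right end of
the support, where `f` may fail to be differentiable. -/
theorem exists_isBest {w : ℝ → ℝ} {S : Set ℝ} {a : EReal} (hw : Continuous w)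
    (hlim : Tendsto w atTop (𝓝 0)) (ha : 0 ≤ w a.toReal) (hS : ∀ y ∈ S, 0 ≤ y)
    (hcl : ∀ y ∈ closure S, 0 < w y → y ∈ S ∪ {a.toReal}) : ∃ z, IsBest w S a z := by
  by_cases hall : ∀ y ∈ S ∪ {a.toReal}, w y ≤ 0
  · exact ⟨a.toReal, Or.inr rfl, fun y hy => (hall y hy).trans ha⟩
  push Not at hall
  obtain ⟨t, ht, htpos⟩ := hall
  obtain ⟨M, hM⟩ := eventually_atTop.1 (hlim.eventually_lt_const htpos)
  set T := (S ∪ {a.toReal}) ∩ {y | w t ≤ w y} with hT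
  have hTc : IsClosed T := by
    refine isClosed_of_closure_subset fun y hy => ?_
    have hy2 : w t ≤ w y := (isClosed_le continuous_const hw).closure_subset_iff.2
      inter_subset_right hy
    refine ⟨?_, hy2⟩
    have hy1 : y ∈ closure (S ∪ {a.toReal}) := closure_mono inter_subset_left hy
    rw [closure_union, closure_singleton] at hy1
    rcases hy1 with h | h
    · exact hcl y h (htpos.trans_le hy2)
    · exact Or.inr h
  have hTb : T ⊆ Icc (min 0 a.toReal) (max M a.toReal) := by
    rintro y ⟨hy, hy2⟩
    rcases hy with hy | hy
    · refine ⟨min_le_of_left_le (hS y hy), le_max_of_le_left ?_⟩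
      by_contra! h
      exact (hM y h.le).not_ge hy2
    · rw [mem_singleton_iff] at hy
      exact ⟨hy ▸ min_le_right _ _, hy ▸ le_max_right _ _⟩
  obtain ⟨z, hz, hmax⟩ := (isCompact_Icc.of_isClosed_subset hTc hTb).exists_isMaxOn
    ⟨t, ht, le_refl (w t)⟩ hw.continuousOn
  refine ⟨z, hz.1, fun y hy => ?_⟩
  rcases le_total (w t) (w y) with h | h
  · exact hmax ⟨hy, h⟩
  · exact h.trans hz.2

end Calculus

/-- The law `μ` of the sources, with density `f`; every cell inside the interval from `α` to `β` has
positive probability, and `f` is differentiable inside this interval. -/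
structure IsSource (μ : Measure ℝ) (f : ℝ → ℝ) (α β : EReal) : Prop where
  prob : IsProbabilityMeasure μ
  null : NullSingletonClass μ
  meas : Measurable f
  nonneg : ∀ x, 0 ≤ f x
  dens : μ = volume.withDensity fun x => ENNReal.ofReal (f x)
  diff : ∀ x : ℝ, α < x → x < β → DifferentiableAt ℝ f x
  pos : ∀ a b : EReal, α ≤ a → a < b → b ≤ β → 0 < μ.real (cell a b)
  lower : 0 ≤ α
  int : Integrable id μ

/-! ### First and second order conditions for `wOne`. -/

namespace IsSource

variable {μ : Measure ℝ} {f : ℝ → ℝ} {α β : EReal}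

theorem integrable_density (h : IsSource μ f α β) : Integrable f := by
  have := h.prob
  refine ⟨h.meas.aestronglyMeasurable, ?_⟩
  rw [hasFiniteIntegral_iff_ofReal (Eventually.of_forall h.nonneg)]
  have h1 : μ univ = ∫⁻ x, ENNReal.ofReal (f x) := by
    rw [h.dens, withDensity_apply _ MeasurableSet.univ, Measure.restrict_univ]
  rw [← h1]
  exact measure_lt_top _ _

theorem F_eq_integral (h : IsSource μ f α β) (z : ℝ) : F μ z = ∫ x in Iic z, f x := by
  have h1 : {y : ℝ | (y : EReal) ≤ z} = Iic z := by
    ext; simp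
  rw [F, h1, Measure.real, h.dens, withDensity_apply _ measurableSet_Iic,
    integral_eq_lintegral_of_nonneg_ae (Eventually.of_forall h.nonneg)
      h.meas.aestronglyMeasurable]

theorem hasDerivAt_F (h : IsSource μ f α β) {z : ℝ} (h1 : α < z) (h2 : z < β) :
    HasDerivAt (fun y : ℝ => F μ y) (f z) z := by
  have hi := h.integrable_density
  have h3 : (fun y : ℝ => F μ y) = fun y => (∫ x in Iic (0 : ℝ), f x) + ∫ x in (0 : ℝ)..y, f x := by
    funext y
    rw [h.F_eq_integral, ← intervalIntegral.integral_Iic_sub_Iic hi.integrableOn hi.integrableOn,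
      add_sub_cancel]
  rw [h3]
  exact (intervalIntegral.integral_hasDerivAt_right hi.intervalIntegrable
    (h.meas.stronglyMeasurable.stronglyMeasurableAtFilter) (h.diff z h1 h2).continuousAt).const_add _

theorem eventually_mem_Ioo {a b : EReal} {z : ℝ} (h1 : a < z) (h2 : z < b) :
    ∀ᶠ y : ℝ in 𝓝 z, a < y ∧ y < b :=
  continuous_coe_real_ereal.continuousAt.eventually (Ioo_mem_nhds h1 h2)

theorem differentiableAt_F (h : IsSource μ f α β) {z : ℝ} (h1 : α < z) (h2 : z < β) :
    DifferentiableAt ℝ (fun y : ℝ => F μ y) z := (h.hasDerivAt_F h1 h2).differentiableAt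

/-- The derivative of `z ↦ z * (1 - (F z - F a) / (F b - F a))`. -/
theorem hasDerivAt_wOne_formula (h : IsSource μ f α β) {a b : EReal} {z : ℝ}
    (h1 : α < z) (h2 : z < β) (hab : 0 < F μ b - F μ a) :
    HasDerivAt (fun y : ℝ => y * (1 - (F μ y - F μ a) / (F μ b - F μ a)))
      ((F μ b - F μ z - z * f z) / (F μ b - F μ a)) z := by
  have := (hasDerivAt_id z).mul
    ((((h.hasDerivAt_F h1 h2).sub_const (F μ a)).div_const (F μ b - F μ a)).const_sub 1)
  refine this.congr_deriv ?_
  simp only [id]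
  field_simp
  ring

theorem hasDerivAt_slopeOne (h : IsSource μ f α β) {a b : EReal} {z : ℝ}
    (h1 : α < z) (h2 : z < β) :
    HasDerivAt (fun z : ℝ => (F μ b - F μ z - z * f z) / (F μ b - F μ a))
      (-(2 * f z + z * deriv f z) / (F μ b - F μ a)) z := by
  have := (((h.hasDerivAt_F h1 h2).const_sub (F μ b)).sub
    ((hasDerivAt_id z).mul (h.diff z h1 h2).hasDerivAt)).div_const (F μ b - F μ a)
  refine this.congr_deriv ?_
  simp only [id]
  ring

/-- The list in terms of the slope of `wOne` and its derivative. The search interval starts at `A`,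
the conditioning cell at `a`: `A = a` serves `ẑ₁*` and `A = b₂` serves `ẑ₁₂*`. -/
theorem mem_solOne_iff (h : IsSource μ f α β) {a A b : EReal} {z : ℝ} (h1 : α < z) (h2 : z < β)
    (hab : 0 < F μ b - F μ a) :
    z ∈ solOne μ f A b ↔ z ∈ cell A b ∧
      (F μ b - F μ z - z * f z) / (F μ b - F μ a) = 0 ∧
      deriv (fun z : ℝ => (F μ b - F μ z - z * f z) / (F μ b - F μ a)) z ≤ 0 := by
  rw [(h.hasDerivAt_slopeOne h1 h2).deriv, div_eq_zero_iff, or_iff_left hab.ne',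
    div_le_iff₀ hab, zero_mul, solOne, mem_ofPred_eq]
  refine and_congr_right fun _ => and_congr ?_ ?_
  · constructor <;> intro <;> linarith
  · exact neg_nonpos.symm

theorem real_cell_pos (h : IsSource μ f α β) {a b : EReal} (ha : α ≤ a) (hab : a < b) (hb : b ≤ β) :
    0 < F μ b - F μ a := by
  have := h.prob
  have := h.null
  rw [← real_cell hab.le]
  exact h.pos a b ha hab hb

theorem toReal_nonneg (h : IsSource μ f α β) {a : EReal} (ha : α ≤ a) : 0 ≤ a.toReal :=
  EReal.toReal_nonneg (h.lower.trans ha)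

theorem nonneg_of_mem_cell (h : IsSource μ f α β) {a b : EReal} {z : ℝ} (ha : α ≤ a)
    (hz : z ∈ cell a b) : 0 ≤ z :=
  EReal.coe_nonneg.1 ((h.lower.trans ha).trans hz.1)

theorem isClosed_cell (a b : EReal) : IsClosed (cell a b) :=
  (isClosed_le continuous_const continuous_coe_real_ereal).inter
    (isClosed_le continuous_coe_real_ereal continuous_const)

theorem lt_of_mem_cell_of_ne {a b : EReal} {z : ℝ} (hz : z ∈ cell a b) (hne : z ≠ a.toReal) :
    a < z := by
  refine lt_of_le_of_ne hz.1 fun h => hne ?_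
  rw [h, EReal.toReal_coe]

/-- Best elements of `solOne` exist. -/
theorem exists_isBest_solOne (h : IsSource μ f α β) {a A b : EReal} (ha : α ≤ a) (haA : a ≤ A)
    (hab : a < b) (hb : b ≤ β) : ∃ z, IsBest (wOne μ a b) (solOne μ f A b) A z := by
  have := h.prob
  have := h.null
  have hpos := h.pos a b ha hab hb
  have hposF := h.real_cell_pos ha hab hb
  refine exists_isBest (continuous_wOne a b) (tendsto_wOne h.int hpos) ?_ ?_ ?_
  · exact mul_nonneg (h.toReal_nonneg (ha.trans haA)) (sub_nonneg.2 (Fcond_le_one _ _ _))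
  · exact fun y hy => h.nonneg_of_mem_cell (ha.trans haA) hy.1
  · intro y hy hwy
    have hyc : y ∈ cell A b := (isClosed_cell A b).closure_subset_iff.2 (fun x hx => hx.1) hy
    by_cases hyA : y = A.toReal
    · exact Or.inr hyA
    refine Or.inl ?_
    have h1 : α < y := (ha.trans haA).trans_lt (lt_of_mem_cell_of_ne hyc hyA)
    -- At `y = b` the objective vanishes, so positivity of `wOne` keeps `y` inside the region of
    -- differentiability.
    have h2 : y < β := by
      refine (lt_of_le_of_ne hyc.2 fun hyb => ?_).trans_le hb
      rw [wOne, Fcond_of_ge hyb.ge hpos] at hwy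
      simp at hwy
    have hzero : ∀ᶠ z : ℝ in 𝓝 y, z ∈ solOne μ f A b →
        (F μ b - F μ z - z * f z) / (F μ b - F μ a) = 0 := by
      filter_upwards [eventually_mem_Ioo h1 h2] with z hz hzS
      exact ((h.mem_solOne_iff hz.1 hz.2 hposF).1 hzS).2.1
    rcases mem_or_deriv_eq_zero_of_mem_closure
      (h.hasDerivAt_slopeOne h1 h2).differentiableAt hzero hy with h3 | h3
    · exact h3
    · exact (h.mem_solOne_iff h1 h2 hposF).2 ⟨hyc, h3.1, h3.2.le⟩

theorem mem_solOne_of_isLocalMax (h : IsSource μ f α β) {a A b : EReal} {z : ℝ} (ha : α ≤ a)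
    (haA : a ≤ A) (hb : b ≤ β) (hAz : A < z) (hzb : z < b) (hz : IsLocalMax (wOne μ a b) z) :
    z ∈ solOne μ f A b := by
  have := h.prob
  have := h.null
  have hposF := h.real_cell_pos ha ((haA.trans_lt hAz).trans hzb) hb
  refine (h.mem_solOne_iff ((ha.trans haA).trans_lt hAz) (hzb.trans_le hb) hposF).2
    ⟨⟨hAz.le, hzb.le⟩, ?_⟩
  refine deriv_nonpos_of_isLocalMax hz
    (g := fun z : ℝ => (F μ b - F μ z - z * f z) / (F μ b - F μ a)) ?_
  -- The derivative at a nearby `y` requires the explicit formula in a whole neighbourhood of `y`,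
  -- hence the nested filter.
  filter_upwards [(eventually_mem_Ioo hAz hzb).eventually_nhds] with y hy
  have hy' := hy.self_of_nhds
  refine (h.hasDerivAt_wOne_formula (a := a) ((ha.trans haA).trans_lt hy'.1) (hy'.2.trans_le hb)
    hposF).congr_of_eventuallyEq ?_
  filter_upwards [hy] with x hx
  rw [wOne, Fcond_eq_div (haA.trans hx.1.le) hx.2.le]

end IsSource

/-- The derivative of `w₁₁ = w₂₁` where the two cells overlap. -/
noncomputable def slopeBoth (μ : Measure ℝ) (f : ℝ → ℝ) (a₁ b₁ a₂ b₂ : EReal) (z : ℝ) : ℝ :=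
  1 - (F μ z - F μ a₁) / (F μ b₁ - F μ a₁) * ((F μ z - F μ a₂) / (F μ b₂ - F μ a₂))
    - z * (f z / (F μ b₁ - F μ a₁) * ((F μ z - F μ a₂) / (F μ b₂ - F μ a₂))
      + (F μ z - F μ a₁) / (F μ b₁ - F μ a₁) * (f z / (F μ b₂ - F μ a₂)))

theorem uniqueDiffOn_cell {a b : EReal} (hab : a < b) : UniqueDiffOn ℝ (cell a b) := by
  refine uniqueDiffOn_convex ?_ ?_
  · refine OrdConnected.convex ⟨fun x hx y hy z hz => ⟨hx.1.trans ?_, le_trans ?_ hy.2⟩⟩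
    · exact EReal.coe_le_coe_iff.2 hz.1
    · exact EReal.coe_le_coe_iff.2 hz.2
  · obtain ⟨x, h1, h2⟩ := EReal.lt_iff_exists_real_btwn.1 hab
    refine ⟨x, mem_interior_iff_mem_nhds.2 ?_⟩
    filter_upwards [IsSource.eventually_mem_Ioo h1 h2] with y hy using ⟨hy.1.le, hy.2.le⟩

/-! ### First and second order conditions for `wBoth`, and location of its maximizers. -/

namespace IsSource

variable {μ : Measure ℝ} {f : ℝ → ℝ} {α β : EReal}

theorem hasDerivAt_wBoth_formula (h : IsSource μ f α β) (a₁ b₁ a₂ b₂ : EReal) {z : ℝ}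
    (h1 : α < z) (h2 : z < β) :
    HasDerivAt (fun y : ℝ => y * (1 - (F μ y - F μ a₁) / (F μ b₁ - F μ a₁) *
      ((F μ y - F μ a₂) / (F μ b₂ - F μ a₂)))) (slopeBoth μ f a₁ b₁ a₂ b₂ z) z := by
  have hF := h.hasDerivAt_F h1 h2
  have := (hasDerivAt_id z).mul
    ((((hF.sub_const (F μ a₁)).div_const (F μ b₁ - F μ a₁)).mul
      ((hF.sub_const (F μ a₂)).div_const (F μ b₂ - F μ a₂))).const_sub 1)
  refine this.congr_deriv ?_
  simp only [id, slopeBoth, Pi.mul_apply]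
  ring

theorem differentiableAt_slopeBoth (h : IsSource μ f α β) (a₁ b₁ a₂ b₂ : EReal) {z : ℝ}
    (h1 : α < z) (h2 : z < β) : DifferentiableAt ℝ (slopeBoth μ f a₁ b₁ a₂ b₂) z := by
  have hF := h.differentiableAt_F h1 h2
  have hf := h.diff z h1 h2
  unfold slopeBoth
  fun_prop

theorem wBoth_eq_formula [IsProbabilityMeasure μ] [NullSingletonClass μ] {a₁ b₁ a₂ b₂ : EReal}
    (hb : b₂ ≤ b₁) {z : ℝ} (hz : z ∈ cell (max a₁ a₂) b₂) :
    wBoth μ a₁ b₁ a₂ b₂ z = z * (1 - (F μ z - F μ a₁) / (F μ b₁ - F μ a₁) *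
      ((F μ z - F μ a₂) / (F μ b₂ - F μ a₂))) := by
  rw [wBoth, Fcond_eq_div ((le_max_left _ _).trans hz.1) (hz.2.trans hb),
    Fcond_eq_div ((le_max_right _ _).trans hz.1) hz.2]

theorem derivWithin_wBoth (h : IsSource μ f α β) {a₁ b₁ a₂ b₂ : EReal} (ha₁ : α ≤ a₁)
    (hm : max a₁ a₂ < b₂) (hb : b₂ ≤ b₁) {z : ℝ}
    (hz : z ∈ cell (max a₁ a₂) b₂) (h1 : max a₁ a₂ < z) (h2 : z < β) :
    derivWithin (wBoth μ a₁ b₁ a₂ b₂) (cell (max a₁ a₂) b₂) z = slopeBoth μ f a₁ b₁ a₂ b₂ z := by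
  have := h.prob
  have := h.null
  have h3 := (h.hasDerivAt_wBoth_formula a₁ b₁ a₂ b₂
    ((ha₁.trans (le_max_left _ _)).trans_lt h1) h2).hasDerivWithinAt (s := cell (max a₁ a₂) b₂)
  exact (h3.congr (fun y hy => wBoth_eq_formula hb hy) (wBoth_eq_formula hb hz)).derivWithin
    (uniqueDiffOn_cell hm z hz)

/-- Inside the cell `wBoth` agrees with a formula that is differentiable beyond `b₂` whenever `b₂ <
β`. One-sided derivatives at `b₂` are therefore ordinary derivatives of the formula, although
`wBoth` itself may have a kink there. The left end `m` is excluded; it is a boundary value anyway.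
-/
theorem mem_solBoth_iff (h : IsSource μ f α β) {a₁ b₁ a₂ b₂ : EReal} (ha₁ : α ≤ a₁)
    (hm : max a₁ a₂ < b₂) (hb : b₂ ≤ b₁) {z : ℝ} (h1 : max a₁ a₂ < z) (h2 : z < β) :
    z ∈ solBoth (wBoth μ a₁ b₁ a₂ b₂) (max a₁ a₂) b₂ ↔ z ∈ cell (max a₁ a₂) b₂ ∧
      slopeBoth μ f a₁ b₁ a₂ b₂ z = 0 ∧ deriv (slopeBoth μ f a₁ b₁ a₂ b₂) z ≤ 0 := by
  refine and_congr_right fun hz => ?_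
  have h3 : derivWithin (wBoth μ a₁ b₁ a₂ b₂) (cell (max a₁ a₂) b₂) =ᶠ[𝓝[cell (max a₁ a₂) b₂] z]
      slopeBoth μ f a₁ b₁ a₂ b₂ := by
    filter_upwards [self_mem_nhdsWithin,
      (eventually_mem_Ioo h1 h2).filter_mono nhdsWithin_le_nhds] with y hy hy2
    exact h.derivWithin_wBoth ha₁ hm hb hy hy2.1 hy2.2
  have h4 := h.derivWithin_wBoth ha₁ hm hb hz h1 h2
  rw [h3.derivWithin_eq h4, h4, DifferentiableAt.derivWithin
    (h.differentiableAt_slopeBoth _ _ _ _ ((ha₁.trans (le_max_left _ _)).trans_lt h1) h2)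
    (uniqueDiffOn_cell hm z hz)]

theorem wBoth_of_ge_right [IsProbabilityMeasure μ] {a₁ b₁ a₂ b₂ : EReal} {z : ℝ} (hz : b₂ ≤ z)
    (hpos : 0 < μ.real (cell a₂ b₂)) : wBoth μ a₁ b₁ a₂ b₂ z = wOne μ a₁ b₁ z := by
  rw [wBoth, wOne, Fcond_of_ge hz hpos, mul_one]

theorem wOne_of_ge [IsProbabilityMeasure μ] {a b : EReal} {z : ℝ} (hz : b ≤ z)
    (hpos : 0 < μ.real (cell a b)) : wOne μ a b z = 0 := by
  rw [wOne, Fcond_of_ge hz hpos, sub_self, mul_zero]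

theorem wBoth_nonneg [IsProbabilityMeasure μ] {a₁ b₁ a₂ b₂ : EReal} {z : ℝ} (hz : 0 ≤ z) :
    0 ≤ wBoth μ a₁ b₁ a₂ b₂ z :=
  mul_nonneg hz (sub_nonneg.2 (mul_le_one₀ (Fcond_le_one _ _ _) (Fcond_nonneg _ _ _)
    (Fcond_le_one _ _ _)))

theorem wBoth_nonpos [IsProbabilityMeasure μ] {a₁ b₁ a₂ b₂ : EReal} {z : ℝ} (hz : z ≤ 0) :
    wBoth μ a₁ b₁ a₂ b₂ z ≤ 0 :=
  mul_nonpos_of_nonpos_of_nonneg hz (sub_nonneg.2 (mul_le_one₀ (Fcond_le_one _ _ _)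
    (Fcond_nonneg _ _ _) (Fcond_le_one _ _ _)))

/-- Best elements of `solBoth` exist. -/
theorem exists_isBest_solBoth (h : IsSource μ f α β) {a₁ b₁ a₂ b₂ : EReal} (ha₁ : α ≤ a₁)
    (ha₂ : α ≤ a₂) (hm : max a₁ a₂ < b₂) (hb : b₂ ≤ b₁) (hb₁ : b₁ ≤ β) :
    ∃ z, IsZ11 μ a₁ b₁ a₂ b₂ z := by
  have := h.prob
  have := h.null
  have hpos₁ := h.pos a₁ b₁ ha₁ (((le_max_left _ _).trans_lt hm).trans_le hb) hb₁
  have hpos₂ := h.pos a₂ b₂ ha₂ ((le_max_right _ _).trans_lt hm) (hb.trans hb₁)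
  have hαm : α ≤ max a₁ a₂ := ha₁.trans (le_max_left _ _)
  refine exists_isBest (continuous_wBoth _ _ _ _) (tendsto_wBoth h.int hpos₁ hpos₂) ?_ ?_ ?_
  · exact wBoth_nonneg (h.toReal_nonneg hαm)
  · exact fun y hy => h.nonneg_of_mem_cell hαm hy.1
  · intro y hy hwy
    have hyc : y ∈ cell (max a₁ a₂) b₂ :=
      (isClosed_cell _ _).closure_subset_iff.2 (fun x hx => hx.1) hy
    by_cases hyA : y = (max a₁ a₂).toReal
    · exact Or.inr hyA
    refine Or.inl ?_
    have h1 : max a₁ a₂ < y := lt_of_mem_cell_of_ne hyc hyA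
    have h2 : y < β := by
      refine lt_of_lt_of_le (lt_of_not_ge fun hyb => ?_) hb₁
      rw [wBoth_of_ge_right (hb.trans hyb) hpos₂, wOne_of_ge hyb hpos₁] at hwy
      exact lt_irrefl _ hwy
    have hzero : ∀ᶠ z in 𝓝 y, z ∈ solBoth (wBoth μ a₁ b₁ a₂ b₂) (max a₁ a₂) b₂ →
        slopeBoth μ f a₁ b₁ a₂ b₂ z = 0 := by
      filter_upwards [eventually_mem_Ioo h1 h2] with z hz hzS
      exact ((h.mem_solBoth_iff ha₁ hm hb hz.1 hz.2).1 hzS).2.1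
    rcases mem_or_deriv_eq_zero_of_mem_closure
      (h.differentiableAt_slopeBoth a₁ b₁ a₂ b₂ (hαm.trans_lt h1) h2) hzero hy with h3 | h3
    · exact h3
    · exact (h.mem_solBoth_iff ha₁ hm hb h1 h2).2 ⟨hyc, h3.1, h3.2.le⟩

theorem mem_solBoth_of_isLocalMax (h : IsSource μ f α β) {a₁ b₁ a₂ b₂ : EReal} {z : ℝ}
    (ha₁ : α ≤ a₁) (hb : b₂ ≤ b₁) (hb₁ : b₁ ≤ β) (h1 : max a₁ a₂ < z) (h2 : z < b₂)
    (hz : IsLocalMax (wBoth μ a₁ b₁ a₂ b₂) z) :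
    z ∈ solBoth (wBoth μ a₁ b₁ a₂ b₂) (max a₁ a₂) b₂ := by
  have := h.prob
  have := h.null
  refine (h.mem_solBoth_iff ha₁ (h1.trans h2) hb h1 (h2.trans_le (hb.trans hb₁))).2
    ⟨⟨h1.le, h2.le⟩, ?_⟩
  refine deriv_nonpos_of_isLocalMax hz ?_
  filter_upwards [(eventually_mem_Ioo h1 h2).eventually_nhds] with y hy
  have hy' := hy.self_of_nhds
  refine (h.hasDerivAt_wBoth_formula a₁ b₁ a₂ b₂ ((ha₁.trans (le_max_left _ _)).trans_lt hy'.1)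
    (hy'.2.trans_le (hb.trans hb₁))).congr_of_eventuallyEq ?_
  filter_upwards [hy] with x hx
  exact wBoth_eq_formula hb ⟨hx.1.le, hx.2.le⟩

/-- The objective `w₁₁ = w₂₁` attains its maximum over the real line. -/
theorem exists_forall_wBoth_le (h : IsSource μ f α β) {a₁ b₁ a₂ b₂ : EReal} (ha₁ : α ≤ a₁)
    (ha₂ : α ≤ a₂) (hab₁ : a₁ < b₁) (hab₂ : a₂ < b₂) (hb₁ : b₁ ≤ β) (hb₂ : b₂ ≤ β) :
    ∃ z, ∀ y, wBoth μ a₁ b₁ a₂ b₂ y ≤ wBoth μ a₁ b₁ a₂ b₂ z := by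
  have := h.prob
  have := h.null
  -- A global maximizer is a best element of the closed list of all nonnegative reals; negative
  -- points have nonpositive value.
  obtain ⟨z, hz, hmax⟩ := exists_isBest (S := Ici 0) (a := 0)
    (continuous_wBoth (μ := μ) a₁ b₁ a₂ b₂)
    (tendsto_wBoth h.int (h.pos a₁ b₁ ha₁ hab₁ hb₁) (h.pos a₂ b₂ ha₂ hab₂ hb₂))
    (by simp [wBoth]) (fun _ hy => hy) (fun y hy _ => Or.inl (isClosed_Ici.closure_subset hy))
  refine ⟨z, fun y => ?_⟩
  rcases le_total 0 y with hy | hy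
  · exact hmax y (Or.inl hy)
  · refine (wBoth_nonpos hy).trans ?_
    have := hmax 0 (Or.inl (mem_Ici.2 le_rfl))
    rwa [wBoth, zero_mul] at this

theorem wBoth_of_le [IsProbabilityMeasure μ] [NullSingletonClass μ] {a₁ b₁ a₂ b₂ : EReal} {z : ℝ}
    (hz : z ≤ max a₁ a₂) : wBoth μ a₁ b₁ a₂ b₂ z = z := by
  rcases le_max_iff.1 hz with hz | hz <;> simp [wBoth, Fcond_of_le hz]

/-- A maximizer of `w₁₁` lies between the larger lower end point and the larger upper end point of
the two cells. -/
theorem mem_of_forall_wBoth_le (h : IsSource μ f α β) {a₁ b₁ a₂ b₂ : EReal} (ha₁ : α ≤ a₁)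
    (ha₂ : α ≤ a₂) (hab₁ : a₁ < b₁) (hab₂ : a₂ < b₂) (hb : b₂ ≤ b₁) (hb₁ : b₁ ≤ β) {z : ℝ}
    (hz : ∀ y, wBoth μ a₁ b₁ a₂ b₂ y ≤ wBoth μ a₁ b₁ a₂ b₂ z) :
    max a₁ a₂ ≤ z ∧ z < b₁ := by
  have := h.prob
  have := h.null
  have hm : max a₁ a₂ < b₁ := max_lt hab₁ (hab₂.trans_le hb)
  -- Any real `x` strictly between `m` and `b₁` is positive with `F₁ x < 1`, so the maximum is
  -- positive and is not attained from `b₁` on.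
  have hpos : 0 < wBoth μ a₁ b₁ a₂ b₂ z := by
    obtain ⟨x, hx1, hx2⟩ := EReal.lt_iff_exists_real_btwn.1 hm
    refine lt_of_lt_of_le ?_ (hz x)
    have hx0 : 0 < x := EReal.coe_pos.1
      ((h.lower.trans (ha₁.trans (le_max_left _ _))).trans_lt hx1)
    have hF : Fcond μ a₁ b₁ x < 1 := Fcond_lt_one
      (h.pos _ _ (ha₁.trans (le_max_left _ _)) (max_lt hab₁ hx2) hb₁)
    refine mul_pos hx0 (sub_pos.2 ?_)
    nlinarith [Fcond_le_one (μ := μ) a₂ b₂ x, Fcond_nonneg (μ := μ) a₁ b₁ x]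
  refine ⟨?_, lt_of_not_ge fun hbz => ?_⟩
  -- Below `m` the objective is the identity, so `m` itself would do strictly better; `m` is real
  -- because it lies between `z` and `b₁`.
  · by_contra! hlt
    have hm' : ((max a₁ a₂).toReal : EReal) = max a₁ a₂ :=
      EReal.coe_toReal hm.ne_top (ne_bot_of_gt hlt)
    have h1 := hz (max a₁ a₂).toReal
    rw [wBoth_of_le hm'.le, wBoth_of_le hlt.le] at h1
    rw [← hm', EReal.coe_lt_coe_iff] at hlt
    exact hlt.not_ge h1
  · rw [wBoth_of_ge_right (hb.trans hbz) (h.pos a₂ b₂ ha₂ hab₂ (hb.trans hb₁)),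
      wOne_of_ge hbz (h.pos a₁ b₁ ha₁ hab₁ hb₁)] at hpos
    exact lt_irrefl _ hpos

end IsSource

/-! ### Maximizers of `wBoth` versus best elements of the lists. -/

namespace IsSource

variable {μ : Measure ℝ} {f : ℝ → ℝ} {α β : EReal}

/-- Lets candidates of the upper list be compared through `wBoth`: they lie above `b₂`, where `F₂ =
1`. If `A = ⊤`, the substitute `0` makes both objectives vanish. -/
theorem wOne_eq_wBoth_of_mem (h : IsSource μ f α β) {a₁ b₁ a₂ b₂ A : EReal}
    (ha₂ : α ≤ a₂) (hab₂ : a₂ < b₂) (hb₂ : b₂ ≤ β) (hA : b₂ ≤ A) {y : ℝ}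
    (hy : y ∈ solOne μ f A b₁ ∪ {A.toReal}) : wOne μ a₁ b₁ y = wBoth μ a₁ b₁ a₂ b₂ y := by
  have := h.prob
  rcases hy with hy | hy
  · exact (wBoth_of_ge_right (hA.trans hy.1.1) (h.pos a₂ b₂ ha₂ hab₂ hb₂)).symm
  · rw [mem_singleton_iff] at hy
    rcases eq_or_ne A ⊤ with hA' | hA'
    · simp [hy, hA', wOne, wBoth]
    · refine (wBoth_of_ge_right (hA.trans ?_) (h.pos a₂ b₂ ha₂ hab₂ hb₂)).symm
      rw [hy]
      exact EReal.le_coe_toReal hA'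

/-- A maximizer of `w₁₁` above `A` is a best element of `solOne` on the interval from `A` to `b₁`. -/
theorem isBest_solOne_of_forall_wBoth_le (h : IsSource μ f α β) {a₁ b₁ a₂ b₂ A : EReal}
    (ha₁ : α ≤ a₁) (ha₂ : α ≤ a₂) (hab₂ : a₂ < b₂) (hb₁ : b₁ ≤ β) (hb₂ : b₂ ≤ β) (hA : b₂ ≤ A)
    (haA : a₁ ≤ A) {z : ℝ} (hz : ∀ y, wBoth μ a₁ b₁ a₂ b₂ y ≤ wBoth μ a₁ b₁ a₂ b₂ z)
    (hAz : A ≤ z) (hzb : z < b₁) : IsBest (wOne μ a₁ b₁) (solOne μ f A b₁) A z := by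
  have := h.prob
  have hmem : z ∈ solOne μ f A b₁ ∪ {A.toReal} := by
    rcases hAz.eq_or_lt with hAz | hAz
    · refine Or.inr ?_
      rw [hAz, EReal.toReal_coe]
      exact mem_singleton z
    · refine Or.inl (h.mem_solOne_of_isLocalMax ha₁ haA hb₁ hAz hzb ?_)
      filter_upwards [eventually_mem_Ioo hAz hzb] with y hy
      rw [← wBoth_of_ge_right (hA.trans hy.1.le) (h.pos a₂ b₂ ha₂ hab₂ hb₂),
        ← wBoth_of_ge_right (hA.trans hAz.le) (h.pos a₂ b₂ ha₂ hab₂ hb₂)]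
      exact hz y
  refine ⟨hmem, fun y hy => ?_⟩
  rw [h.wOne_eq_wBoth_of_mem ha₂ hab₂ hb₂ hA hy, h.wOne_eq_wBoth_of_mem ha₂ hab₂ hb₂ hA hmem]
  exact hz y

theorem isZ1_of_forall_wBoth_le (h : IsSource μ f α β) {a₁ b₁ a₂ b₂ : EReal}
    (ha₁ : α ≤ a₁) (ha₂ : α ≤ a₂) (hab₁ : a₁ < b₁) (hab₂ : a₂ < b₂) (hb₁ : b₁ ≤ β)
    (hba : b₂ ≤ a₁) {z : ℝ} (hz : ∀ y, wBoth μ a₁ b₁ a₂ b₂ y ≤ wBoth μ a₁ b₁ a₂ b₂ z) :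
    IsZ1 μ f a₁ b₁ z := by
  have hb := hba.trans hab₁.le
  obtain ⟨h1, h2⟩ := h.mem_of_forall_wBoth_le ha₁ ha₂ hab₁ hab₂ hb hb₁ hz
  exact h.isBest_solOne_of_forall_wBoth_le ha₁ ha₂ hab₂ hb₁ (hb.trans hb₁) hba le_rfl hz
    ((le_max_left _ _).trans h1) h2

/-- Some global maximizer exists and is on the list, so a best element of the list does at least as
well. -/
theorem forall_wBoth_le_of_isZ1 (h : IsSource μ f α β) {a₁ b₁ a₂ b₂ : EReal}
    (ha₁ : α ≤ a₁) (ha₂ : α ≤ a₂) (hab₁ : a₁ < b₁) (hab₂ : a₂ < b₂) (hb₁ : b₁ ≤ β)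
    (hba : b₂ ≤ a₁) {z : ℝ} (hz : IsZ1 μ f a₁ b₁ z) (y : ℝ) :
    wBoth μ a₁ b₁ a₂ b₂ y ≤ wBoth μ a₁ b₁ a₂ b₂ z := by
  have hb₂ := (hba.trans hab₁.le).trans hb₁
  obtain ⟨x, hx⟩ := h.exists_forall_wBoth_le ha₁ ha₂ hab₁ hab₂ hb₁ hb₂
  have hxZ := h.isZ1_of_forall_wBoth_le ha₁ ha₂ hab₁ hab₂ hb₁ hba hx
  refine (hx y).trans ?_
  rw [← h.wOne_eq_wBoth_of_mem ha₂ hab₂ hb₂ hba hxZ.1,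
    ← h.wOne_eq_wBoth_of_mem ha₂ hab₂ hb₂ hba hz.1]
  exact hz.2 x hxZ.1

theorem isZ11_or_isZ12_of_forall_wBoth_le (h : IsSource μ f α β) {a₁ b₁ a₂ b₂ : EReal}
    (ha₁ : α ≤ a₁) (ha₂ : α ≤ a₂) (hm : max a₁ a₂ < b₂) (hb : b₂ ≤ b₁) (hb₁ : b₁ ≤ β) {z : ℝ}
    (hz : ∀ y, wBoth μ a₁ b₁ a₂ b₂ y ≤ wBoth μ a₁ b₁ a₂ b₂ z) :
    IsZ11 μ a₁ b₁ a₂ b₂ z ∨ IsZ12 μ f a₁ b₁ b₂ z := by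
  have hab₂ := (le_max_right _ _).trans_lt hm
  have hab₁ := (le_max_left _ _).trans_lt hm
  obtain ⟨h1, h2⟩ := h.mem_of_forall_wBoth_le ha₁ ha₂ (hab₁.trans_le hb) hab₂ hb hb₁ hz
  -- The point `b₂` goes to the upper piece, where it is the boundary value; a maximum at this
  -- possible kink need not satisfy a derivative condition.
  rcases le_or_gt b₂ z with hbz | hbz
  · exact Or.inr (h.isBest_solOne_of_forall_wBoth_le ha₁ ha₂ hab₂ hb₁ (hb.trans hb₁) le_rfl hab₁.le
      hz hbz h2)
  · refine Or.inl ⟨?_, fun y _ => hz y⟩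
    rcases h1.eq_or_lt with h1 | h1
    · refine Or.inr ?_
      rw [h1, EReal.toReal_coe]
      exact mem_singleton z
    · exact Or.inl (h.mem_solBoth_of_isLocalMax ha₁ hb hb₁ h1 hbz (Eventually.of_forall hz))

theorem wOne_eq_wBoth_of_isZ12 (h : IsSource μ f α β) {a₁ b₁ a₂ b₂ : EReal}
    (ha₂ : α ≤ a₂) (hab₂ : a₂ < b₂) (hb : b₂ ≤ β) {z : ℝ} (hz : IsZ12 μ f a₁ b₁ b₂ z) :
    wOne μ a₁ b₁ z = wBoth μ a₁ b₁ a₂ b₂ z :=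
  h.wOne_eq_wBoth_of_mem ha₂ hab₂ hb le_rfl hz.1

theorem wBoth_le_max (h : IsSource μ f α β) {a₁ b₁ a₂ b₂ : EReal}
    (ha₁ : α ≤ a₁) (ha₂ : α ≤ a₂) (hm : max a₁ a₂ < b₂) (hb : b₂ ≤ b₁) (hb₁ : b₁ ≤ β) {z z' : ℝ}
    (hz : IsZ11 μ a₁ b₁ a₂ b₂ z) (hz' : IsZ12 μ f a₁ b₁ b₂ z') (y : ℝ) :
    wBoth μ a₁ b₁ a₂ b₂ y ≤ max (wBoth μ a₁ b₁ a₂ b₂ z) (wOne μ a₁ b₁ z') := by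
  have hab₂ := (le_max_right _ _).trans_lt hm
  have hab₁ := (le_max_left _ _).trans_lt hm
  obtain ⟨x, hx⟩ := h.exists_forall_wBoth_le ha₁ ha₂ (hab₁.trans_le hb) hab₂ hb₁ (hb.trans hb₁)
  refine (hx y).trans ?_
  rcases h.isZ11_or_isZ12_of_forall_wBoth_le ha₁ ha₂ hm hb hb₁ hx with hx | hx
  · exact le_max_of_le_left (hz.2 x hx.1)
  · rw [← h.wOne_eq_wBoth_of_isZ12 ha₂ hab₂ (hb.trans hb₁) hx]
    exact le_max_of_le_right (hz'.2 x hx.1)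

/-- The value of `w₁₁` at the better one of the two candidates. -/
theorem wBoth_ite_eq_max (h : IsSource μ f α β) {a₁ b₁ a₂ b₂ : EReal} (ha₂ : α ≤ a₂)
    (hab₂ : a₂ < b₂) (hb₂ : b₂ ≤ β) {z z' : ℝ} (hz' : IsZ12 μ f a₁ b₁ b₂ z') :
    wBoth μ a₁ b₁ a₂ b₂ (if wOne μ a₁ b₁ z' ≤ wBoth μ a₁ b₁ a₂ b₂ z then z else z') =
      max (wBoth μ a₁ b₁ a₂ b₂ z) (wOne μ a₁ b₁ z') := by
  split_ifs with hle
  · rw [max_eq_left hle]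
  · rw [max_eq_right (not_le.1 hle).le, h.wOne_eq_wBoth_of_isZ12 ha₂ hab₂ hb₂ hz']

theorem eq_toReal_of_mem_self {a : EReal} {y : ℝ} (hy : y ∈ solOne μ f a a ∪ {a.toReal}) :
    y = a.toReal := by
  rcases hy with hy | hy
  · rw [le_antisymm hy.1.1 hy.1.2, EReal.toReal_coe]
  · exact hy

/-- Values as required for `ẑ₁*` exist also for a cell with equal end points. -/
theorem exists_isZ1 (h : IsSource μ f α β) {a b : EReal} (ha : α ≤ a) (hab : a ≤ b) (hb : b ≤ β) :
    ∃ z, IsZ1 μ f a b z := by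
  rcases hab.eq_or_lt with rfl | hab
  · refine ⟨a.toReal, Or.inr rfl, fun y hy => ?_⟩
    rw [eq_toReal_of_mem_self hy]
  · exact h.exists_isBest_solOne ha le_rfl hab hb

end IsSource

/-! ### From quantizers to sources on an interval. -/

section Quantizer

variable {μ : Measure ℝ} {f : ℝ → ℝ} {K : ℕ} {ℓ : Fin (K + 1) → EReal}

/-- Consecutive cells share their end points, so a point above `ℓ 0` that misses all cells would, by
induction, lie above every boundary, the last one included. -/
theorem IsQuantizer.mem_support (hℓ : IsQuantizer μ.support ℓ) {x : ℝ} (h0 : ℓ 0 < x)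
    (hK : x < ℓ (Fin.last K)) : x ∈ μ.support := by
  rw [hℓ.cover]
  by_contra hx
  have hx' : ∀ k : Fin K, ℓ k.castSucc ≤ x → ¬ (x : EReal) ≤ ℓ k.succ :=
    fun k h1 h2 => hx (mem_iUnion.2 ⟨k, h1, h2⟩)
  have hall : ∀ j : Fin (K + 1), ℓ j ≤ x := by
    intro j
    induction j using Fin.induction with
    | zero => exact h0.le
    | succ k ih => exact (not_le.1 (hx' k ih)).le
  exact hK.not_ge (hall _)

theorem IsQuantizer.isSource [IsProbabilityMeasure μ] (hℓ : IsQuantizer μ.support ℓ)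
    (hf : Measurable f) (hf0 : ∀ x, 0 ≤ f x)
    (hdens : μ = volume.withDensity fun x => ENNReal.ofReal (f x))
    (hdiff : DifferentiableOn ℝ f (interior μ.support)) (hnonneg : ∀ᵐ x ∂μ, 0 ≤ x)
    (hint : Integrable id μ) : IsSource μ f (ℓ 0) (ℓ (Fin.last K)) where
  prob := inferInstance
  null := ⟨fun x => by
    rw [hdens]
    exact withDensity_absolutelyContinuous _ _ (measure_singleton x)⟩
  meas := hf
  nonneg := hf0
  dens := hdens
  diff x h1 h2 := by
    have hx : x ∈ interior μ.support := by
      rw [mem_interior_iff_mem_nhds]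
      filter_upwards [IsSource.eventually_mem_Ioo h1 h2] with y hy using hℓ.mem_support hy.1 hy.2
    exact hdiff.differentiableAt (isOpen_interior.mem_nhds hx)
  pos a b ha hab hb := by
    obtain ⟨x, h1, h2⟩ := EReal.lt_iff_exists_real_btwn.1 hab
    have hx := hℓ.mem_support (ha.trans_lt h1) (h2.trans_le hb)
    have hpos : 0 < μ (cell a b) := by
      refine (Measure.mem_support_iff_forall x).1 hx _ ?_
      filter_upwards [IsSource.eventually_mem_Ioo h1 h2] with y hy using ⟨hy.1.le, hy.2.le⟩
    exact ENNReal.toReal_pos hpos.ne' (measure_ne_top _ _)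
  lower := by
    rw [hℓ.first]
    refine le_sInf ?_
    rintro _ ⟨x, hx, rfl⟩
    exact EReal.coe_nonneg.2 (Measure.support_subset_of_isClosed isClosed_Ici hnonneg hx)
  int := hint

theorem IsQuantizer.le_castSucc {S : Set ℝ} (hℓ : IsQuantizer S ℓ) (k : Fin K) :
    ℓ 0 ≤ ℓ k.castSucc := hℓ.mono (Fin.zero_le _)

theorem IsQuantizer.succ_le {S : Set ℝ} (hℓ : IsQuantizer S ℓ) (k : Fin K) :
    ℓ k.succ ≤ ℓ (Fin.last K) := hℓ.mono (Fin.le_last _)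

theorem IsQuantizer.castSucc_le_succ {S : Set ℝ} (hℓ : IsQuantizer S ℓ) (k : Fin K) :
    ℓ k.castSucc ≤ ℓ k.succ := hℓ.mono k.castSucc_lt_succ.le

/-- Up to a null event, the index is determined by the source. -/
theorem IsQuantizer.index_ae_eq [NullSingletonClass μ] {S : Set ℝ} (hℓ : IsQuantizer S ℓ)
    {Ω : Type*} [MeasurableSpace Ω] {P : Measure Ω} {X : Ω → ℝ} (hX : Measurable X)
    (hμ : P.map X = μ) {U : Ω → Fin K}
    (hXU : ∀ᵐ ω ∂P, X ω ∈ cell (ℓ (U ω).castSucc) (ℓ (U ω).succ)) (k : Fin K) :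
    ∀ᵐ ω ∂P, (U ω = k ↔ X ω ∈ cell (ℓ k.castSucc) (ℓ k.succ)) := by
  have hne : ∀ᵐ ω ∂P, ∀ j, (X ω : EReal) ≠ ℓ j := by
    rw [ae_all_iff]
    intro j
    have h1 : ∀ᵐ x : ℝ ∂(P.map X), (x : EReal) ≠ ℓ j := by
      rw [hμ, ae_iff]
      simpa using measure_coe_eq (μ := μ) (ℓ j)
    exact ae_of_ae_map hX.aemeasurable h1
  filter_upwards [hne, hXU] with ω h1 h2
  refine ⟨fun h => h ▸ h2, fun h => ?_⟩
  -- Two different cells meet at most in a common boundary value, and the source almost surely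
  -- avoids all boundaries.
  by_contra hUk
  rcases lt_or_gt_of_ne hUk with hlt | hlt
  · exact h1 _ (le_antisymm (h2.2.trans (hℓ.mono (Fin.succ_le_castSucc_iff.2 hlt))) h.1)
  · exact h1 _ (le_antisymm (h.2.trans (hℓ.mono (Fin.succ_le_castSucc_iff.2 hlt))) h2.1)

end Quantizer

/-! ### The distortion as maximum minus reward, summed over index pairs. -/

section Distortion

variable {Ω : Type*} [MeasurableSpace Ω] {P : Measure Ω} {X₁ X₂ : Ω → ℝ}

theorem dM_eq_sub_indicator (x₁ x₂ z : ℝ) :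
    dM x₁ x₂ z = max x₁ x₂ - z * ({p : ℝ | z ≤ p}.indicator 1 (max x₁ x₂)) := by
  by_cases h : z ≤ max x₁ x₂ <;> simp [dM, indicator, h]

variable [IsProbabilityMeasure P]

theorem integrable_dM (hX₁ : Measurable X₁) (hX₂ : Measurable X₂) (hint₁ : Integrable X₁ P)
    (hint₂ : Integrable X₂ P) {K : ℕ} {U₁ U₂ : Ω → Fin K} (hU₁ : Measurable U₁)
    (hU₂ : Measurable U₂) (g : Fin K × Fin K → ℝ) :
    Integrable (fun ω => dM (X₁ ω) (X₂ ω) (g (U₁ ω, U₂ ω))) P := by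
  have hg : Measurable fun ω => g (U₁ ω, U₂ ω) :=
    (measurable_of_finite g).comp (hU₁.prodMk hU₂)
  have hmax : Measurable fun ω => max (X₁ ω) (X₂ ω) := hX₁.max hX₂
  have hmeas : Measurable fun ω => dM (X₁ ω) (X₂ ω) (g (U₁ ω, U₂ ω)) :=
    Measurable.ite (measurableSet_le hg hmax) (hmax.sub hg) hmax
  refine Integrable.mono' (g := fun ω => |max (X₁ ω) (X₂ ω)| + ∑ k, |g k|)
    ((hint₁.sup hint₂).abs.add (integrable_const _)) hmeas.aestronglyMeasurable
    (Eventually.of_forall fun ω => ?_)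
  have h1 : |g (U₁ ω, U₂ ω)| ≤ ∑ k, |g k| :=
    Finset.single_le_sum (f := fun k => |g k|) (fun k _ => abs_nonneg _) (Finset.mem_univ _)
  have h2 : 0 ≤ |g (U₁ ω, U₂ ω)| := abs_nonneg _
  rw [Real.norm_eq_abs, dM]
  split_ifs
  · exact (abs_sub _ _).trans (by linarith)
  · linarith

theorem setIntegral_dM (hX₁ : Measurable X₁) (hX₂ : Measurable X₂) (hint₁ : Integrable X₁ P)
    (hint₂ : Integrable X₂ P) (s : Set Ω) (z : ℝ) :
    ∫ ω in s, dM (X₁ ω) (X₂ ω) z ∂P =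
      (∫ ω in s, max (X₁ ω) (X₂ ω) ∂P) - z * P.real ({ω | z ≤ max (X₁ ω) (X₂ ω)} ∩ s) := by
  have hT : MeasurableSet {ω | z ≤ max (X₁ ω) (X₂ ω)} :=
    measurableSet_le measurable_const (hX₁.max hX₂)
  have h1 : (fun ω => dM (X₁ ω) (X₂ ω) z) = fun ω => max (X₁ ω) (X₂ ω) -
      z * {ω | z ≤ max (X₁ ω) (X₂ ω)}.indicator 1 ω := by
    funext ω
    exact dM_eq_sub_indicator _ _ _
  have h2 : Integrable (fun ω => max (X₁ ω) (X₂ ω)) P := hint₁.sup hint₂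
  have h3 : Integrable (fun ω => z * {ω | z ≤ max (X₁ ω) (X₂ ω)}.indicator (1 : Ω → ℝ) ω) P :=
    ((integrable_const (1 : ℝ)).indicator hT).const_mul z
  rw [h1, integral_sub h2.integrableOn h3.integrableOn, integral_const_mul,
    integral_indicator_one hT, measureReal_restrict_apply hT]

omit [IsProbabilityMeasure P] in
theorem integral_cond (s : Set Ω) (g : Ω → ℝ) :
    ∫ ω, g ω ∂(ProbabilityTheory.cond P s) = (P.real s)⁻¹ * ∫ ω in s, g ω ∂P := by
  rw [ProbabilityTheory.cond, integral_smul_measure, ENNReal.toReal_inv, smul_eq_mul]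
  rfl

theorem distortion_eq_sum (hX₁ : Measurable X₁) (hX₂ : Measurable X₂) (hint₁ : Integrable X₁ P)
    (hint₂ : Integrable X₂ P) {K : ℕ} {U₁ U₂ : Ω → Fin K} (hU₁ : Measurable U₁)
    (hU₂ : Measurable U₂) (g : Fin K × Fin K → ℝ) :
    distortion P X₁ X₂ U₁ U₂ g =
      ∑ k, ∫ ω in {ω | U₁ ω = k.1 ∧ U₂ ω = k.2}, dM (X₁ ω) (X₂ ω) (g k) ∂P := by
  have hE : ∀ k : Fin K × Fin K, MeasurableSet {ω | U₁ ω = k.1 ∧ U₂ ω = k.2} := fun k =>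
    (hU₁ (measurableSet_singleton k.1)).inter (hU₂ (measurableSet_singleton k.2))
  have hint := integrable_dM hX₁ hX₂ hint₁ hint₂ hU₁ hU₂ g
  have hunion : (⋃ k : Fin K × Fin K, {ω | U₁ ω = k.1 ∧ U₂ ω = k.2}) = univ :=
    eq_univ_of_forall fun ω => mem_iUnion.2 ⟨(U₁ ω, U₂ ω), rfl, rfl⟩
  rw [distortion, ← setIntegral_univ, ← hunion, integral_iUnion_fintype hE ?_
    fun k => hint.integrableOn]
  · refine Finset.sum_congr rfl fun k _ => setIntegral_congr_fun (hE k) ?_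
    rintro ω ⟨h1, h2⟩
    simp only [h1, h2, Prod.mk.eta]
  · intro k j hkj
    refine disjoint_left.2 fun ω h1 h2 => hkj ?_
    exact Prod.ext (h1.1.symm.trans h2.1) (h1.2.symm.trans h2.2)

end Distortion

/-! ### Bayes estimates as maximizers, and the expected maximum by Fubini. -/

section Bayes

variable {Ω : Type*} [MeasurableSpace Ω] {P : Measure Ω} [IsProbabilityMeasure P] {X₁ X₂ : Ω → ℝ}

theorem condDistortion_eq_sub_gain (hX₁ : Measurable X₁) (hX₂ : Measurable X₂)
    (hint₁ : Integrable X₁ P) (hint₂ : Integrable X₂ P) {K : ℕ} {U₁ U₂ : Ω → Fin K}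
    {k : Fin K × Fin K} {L₁ L₂ : Set ℝ} (hL₁ : MeasurableSet L₁) (hL₂ : MeasurableSet L₂)
    (hE : {ω | U₁ ω = k.1 ∧ U₂ ω = k.2} =ᵐ[P] {ω | X₁ ω ∈ L₁ ∧ X₂ ω ∈ L₂}) (z : ℝ) :
    condDistortion P X₁ X₂ U₁ U₂ k z =
      (P.real {ω | X₁ ω ∈ L₁ ∧ X₂ ω ∈ L₂})⁻¹ *
        (∫ ω in {ω | X₁ ω ∈ L₁ ∧ X₂ ω ∈ L₂}, max (X₁ ω) (X₂ ω) ∂P) - gain P X₁ X₂ L₁ L₂ z := by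
  have hC : MeasurableSet {ω | X₁ ω ∈ L₁ ∧ X₂ ω ∈ L₂} := (hX₁ hL₁).inter (hX₂ hL₂)
  rw [condDistortion, integral_cond, measureReal_congr hE, setIntegral_congr_set hE,
    setIntegral_dM hX₁ hX₂ hint₁ hint₂, gain]
  simp only [Measure.real, cond_apply hC, ENNReal.toReal_mul, ENNReal.toReal_inv]
  rw [inter_comm]
  ring

theorem isBayes_iff_gain (hX₁ : Measurable X₁) (hX₂ : Measurable X₂)
    (hint₁ : Integrable X₁ P) (hint₂ : Integrable X₂ P) {K : ℕ} {U₁ U₂ : Ω → Fin K}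
    {k : Fin K × Fin K} {L₁ L₂ : Set ℝ} (hL₁ : MeasurableSet L₁) (hL₂ : MeasurableSet L₂)
    (hE : {ω | U₁ ω = k.1 ∧ U₂ ω = k.2} =ᵐ[P] {ω | X₁ ω ∈ L₁ ∧ X₂ ω ∈ L₂}) (z : ℝ) :
    IsBayes P X₁ X₂ U₁ U₂ k z ↔ ∀ y, gain P X₁ X₂ L₁ L₂ y ≤ gain P X₁ X₂ L₁ L₂ z := by
  refine forall_congr' fun y => ?_
  rw [condDistortion_eq_sub_gain hX₁ hX₂ hint₁ hint₂ hL₁ hL₂ hE,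
    condDistortion_eq_sub_gain hX₁ hX₂ hint₁ hint₂ hL₁ hL₂ hE, sub_le_sub_iff_left]

variable {μ : Measure ℝ}

omit [IsProbabilityMeasure P] in
theorem measureReal_mem_mem (hX₁ : Measurable X₁) (hX₂ : Measurable X₂)
    (hindep : IndepFun X₁ X₂ P) (hμ₁ : P.map X₁ = μ) (hμ₂ : P.map X₂ = μ)
    {A B : Set ℝ} (hA : MeasurableSet A) (hB : MeasurableSet B) :
    P.real {ω | X₁ ω ∈ A ∧ X₂ ω ∈ B} = μ.real A * μ.real B := by
  have h := hindep.measure_inter_preimage_eq_mul A B hA hB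
  rw [Measure.real, Measure.real, Measure.real, ← ENNReal.toReal_mul]
  congr 1
  rw [← Measure.map_apply hX₁ hA, ← Measure.map_apply hX₂ hB, hμ₁, hμ₂] at h
  exact h

theorem gain_eq_wBoth [IsProbabilityMeasure μ] [NullSingletonClass μ] (hX₁ : Measurable X₁)
    (hX₂ : Measurable X₂) (hindep : IndepFun X₁ X₂ P) (hμ₁ : P.map X₁ = μ) (hμ₂ : P.map X₂ = μ)
    {a₁ b₁ a₂ b₂ : EReal} (hpos₁ : 0 < μ.real (cell a₁ b₁)) (hpos₂ : 0 < μ.real (cell a₂ b₂))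
    (z : ℝ) : gain P X₁ X₂ (cell a₁ b₁) (cell a₂ b₂) z = wBoth μ a₁ b₁ a₂ b₂ z := by
  have hL₁ := measurableSet_cell a₁ b₁
  have hL₂ := measurableSet_cell a₂ b₂
  have hC : MeasurableSet {ω | X₁ ω ∈ cell a₁ b₁ ∧ X₂ ω ∈ cell a₂ b₂} :=
    (hX₁ hL₁).inter (hX₂ hL₂)
  have hPC := measureReal_mem_mem hX₁ hX₂ hindep hμ₁ hμ₂ hL₁ hL₂
  have hprob : IsProbabilityMeasure
      (ProbabilityTheory.cond P {ω | X₁ ω ∈ cell a₁ b₁ ∧ X₂ ω ∈ cell a₂ b₂}) := by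
    refine cond_isProbabilityMeasure fun h0 => ?_
    rw [Measure.real, h0] at hPC
    exact (mul_pos hpos₁ hpos₂).ne hPC
  have hT : MeasurableSet {ω | max (X₁ ω) (X₂ ω) < z} :=
    measurableSet_lt (hX₁.max hX₂) measurable_const
  -- The complementary event requires both sources to be below `z`, so it factors by independence.
  -- Strict and weak inequalities agree without atoms.
  have h1 : {ω | z ≤ max (X₁ ω) (X₂ ω)} = {ω | max (X₁ ω) (X₂ ω) < z}ᶜ := by
    ext ω
    exact (not_lt (a := max (X₁ ω) (X₂ ω)) (b := z)).symm
  have h2 : {ω | X₁ ω ∈ cell a₁ b₁ ∧ X₂ ω ∈ cell a₂ b₂} ∩ {ω | max (X₁ ω) (X₂ ω) < z} =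
      {ω | X₁ ω ∈ cell a₁ b₁ ∩ Iio z ∧ X₂ ω ∈ cell a₂ b₂ ∩ Iio z} := by
    ext ω
    simp only [mem_inter_iff, mem_ofPred_eq, max_lt_iff, mem_Iio]
    tauto
  have h3 : ∀ a b : EReal, μ.real (cell a b ∩ Iio z) = μ.real (cell a b ∩ Iic z) := fun a b =>
    measureReal_congr ((ae_eq_refl _).inter Iio_ae_eq_Iic)
  have h4 : (ProbabilityTheory.cond P {ω | X₁ ω ∈ cell a₁ b₁ ∧ X₂ ω ∈ cell a₂ b₂}).real
      {ω | max (X₁ ω) (X₂ ω) < z} = Fcond μ a₁ b₁ z * Fcond μ a₂ b₂ z := by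
    rw [Measure.real, cond_apply hC, ENNReal.toReal_mul, ENNReal.toReal_inv, ← measureReal_def,
      ← measureReal_def, hPC, h2, measureReal_mem_mem hX₁ hX₂ hindep hμ₁ hμ₂
        (hL₁.inter measurableSet_Iio) (hL₂.inter measurableSet_Iio), h3, h3, Fcond_eq_inv_mul,
      Fcond_eq_inv_mul, mul_inv]
    ring
  rw [gain, h1, probReal_compl_eq_one_sub hT, h4, wBoth]

/-- The expected maximum on a pair of sets, split according to which of the two users has the
maximum. -/
theorem setIntegral_max [IsProbabilityMeasure μ] [NullSingletonClass μ] (hint : Integrable id μ)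
    (hX₁ : Measurable X₁)
    (hX₂ : Measurable X₂) (hindep : IndepFun X₁ X₂ P) (hμ₁ : P.map X₁ = μ) (hμ₂ : P.map X₂ = μ)
    {L₁ L₂ : Set ℝ} (hL₁ : MeasurableSet L₁) (hL₂ : MeasurableSet L₂) :
    ∫ ω in {ω | X₁ ω ∈ L₁ ∧ X₂ ω ∈ L₂}, max (X₁ ω) (X₂ ω) ∂P =
      (∫ x in L₁, x * μ.real (L₂ ∩ Iic x) ∂μ) + ∫ x in L₂, x * μ.real (L₁ ∩ Iic x) ∂μ := by
  have hprod : P.map (fun ω => (X₁ ω, X₂ ω)) = μ.prod μ := by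
    rw [(indepFun_iff_map_prod_eq_prod_map_map hX₁.aemeasurable hX₂.aemeasurable).1 hindep,
      hμ₁, hμ₂]
  have h1 : ∫ ω in {ω | X₁ ω ∈ L₁ ∧ X₂ ω ∈ L₂}, max (X₁ ω) (X₂ ω) ∂P =
      ∫ p, max p.1 p.2 ∂((μ.restrict L₁).prod (μ.restrict L₂)) := by
    rw [Measure.prod_restrict, ← hprod, setIntegral_map (hL₁.prod hL₂)
      (measurable_fst.max measurable_snd).aestronglyMeasurable (hX₁.prodMk hX₂).aemeasurable]
    rfl
  have hi1 : Integrable (fun p : ℝ × ℝ => p.1) ((μ.restrict L₁).prod (μ.restrict L₂)) :=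
    Integrable.comp_fst (f := id) hint.restrict (μ.restrict L₂)
  have hi2 : Integrable (fun p : ℝ × ℝ => p.2) ((μ.restrict L₁).prod (μ.restrict L₂)) :=
    Integrable.comp_snd (f := id) hint.restrict (μ.restrict L₁)
  have hs1 : MeasurableSet {p : ℝ × ℝ | p.2 ≤ p.1} := measurableSet_le measurable_snd measurable_fst
  have hs2 : MeasurableSet {p : ℝ × ℝ | p.1 < p.2} := measurableSet_lt measurable_fst measurable_snd
  -- Ties are assigned to user 1. In each part the smaller coordinate is integrated out first,
  -- leaving its distribution function at the larger one.
  have h2 : (fun p : ℝ × ℝ => max p.1 p.2) = fun p =>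
      {p : ℝ × ℝ | p.2 ≤ p.1}.indicator (fun p => p.1) p +
        {p : ℝ × ℝ | p.1 < p.2}.indicator (fun p => p.2) p := by
    funext p
    rcases le_or_gt p.2 p.1 with h | h
    · simp [indicator, h, not_lt.2 h]
    · simp [indicator, h, not_le.2 h, h.le]
  rw [h1, h2, integral_add (hi1.indicator hs1) (hi2.indicator hs2),
    integral_prod _ (hi1.indicator hs1), integral_prod_symm _ (hi2.indicator hs2)]
  congr 1
  · refine integral_congr_ae (Eventually.of_forall fun x => ?_)
    have h3 : (fun y : ℝ => {p : ℝ × ℝ | p.2 ≤ p.1}.indicator (fun p => p.1) (x, y)) =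
        (Iic x).indicator fun _ => x := by
      funext y
      simp [indicator]
    simp only [h3]
    rw [integral_indicator_const _ measurableSet_Iic, measureReal_restrict_apply measurableSet_Iic,
      inter_comm, smul_eq_mul, mul_comm]
  · refine integral_congr_ae (Eventually.of_forall fun x => ?_)
    have h3 : (fun y : ℝ => {p : ℝ × ℝ | p.1 < p.2}.indicator (fun p => p.2) (y, x)) =
        (Iio x).indicator fun _ => x := by
      funext y
      simp [indicator]
    simp only [h3]
    rw [integral_indicator_const _ measurableSet_Iio, measureReal_restrict_apply measurableSet_Iio,
      inter_comm, smul_eq_mul, mul_comm, measureReal_congr ((ae_eq_refl L₁).inter Iio_ae_eq_Iic)]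

end Bayes

/-! ### Explicit integrals for the expected maximum. -/

section Formula

variable {μ : Measure ℝ} {f : ℝ → ℝ} {α β : EReal}

theorem IsSource.setIntegral_eq (h : IsSource μ f α β) (a b : EReal) (g : ℝ → ℝ) :
    ∫ x in cell a b, g x ∂μ = ∫ x in cell a b, f x * g x := by
  rw [h.dens, setIntegral_withDensity_eq_setIntegral_toReal_smul h.meas.ennreal_ofReal
    (Eventually.of_forall fun _ => ENNReal.ofReal_lt_top) _ (measurableSet_cell a b)]
  simp only [ENNReal.toReal_ofReal (h.nonneg _), smul_eq_mul]

theorem integrable_mul_real_inter_Iic [IsProbabilityMeasure μ] (hint : Integrable id μ)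
    (L : Set ℝ) : Integrable (fun x => x * μ.real (L ∩ Iic x)) μ := by
  have hm : Measurable fun x => μ.real (L ∩ Iic x) :=
    Monotone.measurable fun x y hxy =>
      measureReal_mono (inter_subset_inter_right _ (Iic_subset_Iic.2 hxy))
  refine Integrable.mono' hint.abs (measurable_id.mul hm).aestronglyMeasurable
    (Eventually.of_forall fun x => ?_)
  rw [norm_mul, Real.norm_eq_abs, Real.norm_eq_abs, abs_of_nonneg measureReal_nonneg]
  exact mul_le_of_le_one_right (abs_nonneg x) measureReal_le_one

/-- The expected maximum, restricted to a pair of cells that do not overlap. -/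
theorem IsSource.integral_max_separated (h : IsSource μ f α β) {a₁ b₁ a₂ b₂ : EReal}
    (hab₂ : a₂ ≤ b₂) (hba : b₂ ≤ a₁) :
    (∫ x in cell a₁ b₁, x * μ.real (cell a₂ b₂ ∩ Iic x) ∂μ) +
        ∫ x in cell a₂ b₂, x * μ.real (cell a₁ b₁ ∩ Iic x) ∂μ =
      (∫ x in cell a₁ b₁, x * f x) * (F μ b₂ - F μ a₂) := by
  have := h.prob
  have := h.null
  have h1 : ∫ x in cell a₁ b₁, x * μ.real (cell a₂ b₂ ∩ Iic x) ∂μ =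
      ∫ x in cell a₁ b₁, x * (F μ b₂ - F μ a₂) ∂μ := by
    refine setIntegral_congr_fun (measurableSet_cell _ _) fun x hx => ?_
    have hbx := hba.trans hx.1
    rw [real_cell_inter_Iic hab₂ (hab₂.trans hbx), min_eq_left hbx]
  have h2 : ∫ x in cell a₂ b₂, x * μ.real (cell a₁ b₁ ∩ Iic x) ∂μ = 0 := by
    refine setIntegral_eq_zero_of_forall_eq_zero fun x hx => ?_
    rw [real_cell_inter_Iic_of_le b₁ (hx.2.trans hba), mul_zero]
  rw [h1, h2, add_zero, integral_mul_const, h.setIntegral_eq]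
  simp only [mul_comm]

/-- The expected maximum, restricted to a pair of cells that overlap. -/
theorem IsSource.integral_max_overlap (h : IsSource μ f α β) {a₁ b₁ a₂ b₂ : EReal}
    (hm : max a₁ a₂ ≤ b₂) (hb : b₂ ≤ b₁) :
    (∫ x in cell a₁ b₁, x * μ.real (cell a₂ b₂ ∩ Iic x) ∂μ) +
        ∫ x in cell a₂ b₂, x * μ.real (cell a₁ b₁ ∩ Iic x) ∂μ =
      (∫ z in cell (max a₁ a₂) b₂, z * f z * (2 * F μ z - F μ a₂ - F μ a₁)) +
        ∫ z in cell b₂ b₁, z * f z * (F μ b₂ - F μ a₂) := by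
  have := h.prob
  have := h.null
  have hab₁ : a₁ ≤ b₂ := (le_max_left _ _).trans hm
  have hab₂ : a₂ ≤ b₂ := (le_max_right _ _).trans hm
  have hi1 := integrable_mul_real_inter_Iic h.int (cell a₂ b₂)
  have hi2 := integrable_mul_real_inter_Iic h.int (cell a₁ b₁)
  have h1 : ∫ x in cell a₁ b₁, x * μ.real (cell a₂ b₂ ∩ Iic x) ∂μ =
      ∫ x in cell (max a₁ a₂) b₁, x * μ.real (cell a₂ b₂ ∩ Iic x) ∂μ := by
    refine setIntegral_eq_of_subset_of_forall_sdiff_eq_zero (measurableSet_cell _ _)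
      (fun x hx => ⟨(le_max_left _ _).trans hx.1, hx.2⟩) ?_
    rintro x ⟨hx1, hx2⟩
    have hxa : x ≤ a₂ := le_of_not_ge fun hxa => hx2 ⟨max_le hx1.1 hxa, hx1.2⟩
    rw [real_cell_inter_Iic_of_le b₂ hxa, mul_zero]
  have h2 : ∫ x in cell a₂ b₂, x * μ.real (cell a₁ b₁ ∩ Iic x) ∂μ =
      ∫ x in cell (max a₁ a₂) b₂, x * μ.real (cell a₁ b₁ ∩ Iic x) ∂μ := by
    refine setIntegral_eq_of_subset_of_forall_sdiff_eq_zero (measurableSet_cell _ _)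
      (fun x hx => ⟨(le_max_right _ _).trans hx.1, hx.2⟩) ?_
    rintro x ⟨hx1, hx2⟩
    have hxa : x ≤ a₁ := le_of_not_ge fun hxa => hx2 ⟨max_le hxa hx1.1, hx1.2⟩
    rw [real_cell_inter_Iic_of_le b₁ hxa, mul_zero]
  have hunion : cell (max a₁ a₂) b₁ = cell (max a₁ a₂) b₂ ∪ cell b₂ b₁ := by
    ext x
    constructor
    · exact fun hx => (le_total (x : EReal) b₂).imp (fun h => ⟨hx.1, h⟩) fun h => ⟨h, hx.2⟩
    · rintro (hx | hx)
      exacts [⟨hx.1, hx.2.trans hb⟩, ⟨hm.trans hx.1, hx.2⟩]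
  have hdisj : AEDisjoint μ (cell (max a₁ a₂) b₂) (cell b₂ b₁) :=
    measure_mono_null (fun x hx => le_antisymm hx.1.2 hx.2.1) (measure_coe_eq (μ := μ) b₂)
  have h3 : ∫ x in cell b₂ b₁, x * μ.real (cell a₂ b₂ ∩ Iic x) ∂μ =
      ∫ x in cell b₂ b₁, x * (F μ b₂ - F μ a₂) ∂μ := by
    refine setIntegral_congr_fun (measurableSet_cell _ _) fun x hx => ?_
    rw [real_cell_inter_Iic hab₂ (hab₂.trans hx.1), min_eq_left hx.1]
  have h4 : (∫ x in cell (max a₁ a₂) b₂, x * μ.real (cell a₂ b₂ ∩ Iic x) ∂μ) +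
      ∫ x in cell (max a₁ a₂) b₂, x * μ.real (cell a₁ b₁ ∩ Iic x) ∂μ =
      ∫ x in cell (max a₁ a₂) b₂, x * (2 * F μ x - F μ a₂ - F μ a₁) ∂μ := by
    rw [← integral_add hi1.integrableOn hi2.integrableOn]
    refine setIntegral_congr_fun (measurableSet_cell _ _) fun x hx => ?_
    rw [real_cell_inter_Iic hab₂ ((le_max_right _ _).trans hx.1), min_eq_right hx.2,
      real_cell_inter_Iic (hab₁.trans hb) ((le_max_left _ _).trans hx.1),
      min_eq_right (hx.2.trans hb)]
    ring
  rw [h1, h2, hunion, setIntegral_union₀ hdisj (measurableSet_cell _ _).nullMeasurableSet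
    hi1.integrableOn hi1.integrableOn, h3, add_right_comm, h4, h.setIntegral_eq, h.setIntegral_eq]
  congr 1 <;> exact integral_congr_ae (Eventually.of_forall fun x => by simp only; ring)

end Formula

/-! ### Region by region: existence, optimality and the terms of `D`. -/

section Estimator

variable {μ : Measure ℝ} {f : ℝ → ℝ} {K : ℕ} {ℓ₁ ℓ₂ : Fin (K + 1) → EReal}

theorem mem_Z1 {k : Fin K × Fin K} : k ∈ Z1 ℓ₁ ℓ₂ ↔ ℓ₂ k.2.succ ≤ ℓ₁ k.1.castSucc := by
  simp [Z1]

theorem mem_Z2 {k : Fin K × Fin K} : k ∈ Z2 ℓ₁ ℓ₂ ↔ ℓ₁ k.1.succ ≤ ℓ₂ k.2.castSucc := by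
  simp [Z2]

theorem mem_Z01 {k : Fin K × Fin K} : k ∈ Z01 ℓ₁ ℓ₂ ↔
    max (ℓ₁ k.1.castSucc) (ℓ₂ k.2.castSucc) < ℓ₂ k.2.succ ∧ ℓ₂ k.2.succ ≤ ℓ₁ k.1.succ := by
  simp [Z01]

theorem mem_Z02 {k : Fin K × Fin K} : k ∈ Z02 ℓ₁ ℓ₂ ↔
    max (ℓ₁ k.1.castSucc) (ℓ₂ k.2.castSucc) < ℓ₁ k.1.succ ∧ ℓ₁ k.1.succ < ℓ₂ k.2.succ := by
  simp [Z02]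

/-- Two cells with distinct end points are in exactly one of the four regions. -/
theorem region_cases {k : Fin K × Fin K} (h1 : ℓ₁ k.1.castSucc < ℓ₁ k.1.succ)
    (h2 : ℓ₂ k.2.castSucc < ℓ₂ k.2.succ) :
    (k ∈ Z1 ℓ₁ ℓ₂ ∧ k ∉ Z2 ℓ₁ ℓ₂ ∧ k ∉ Z01 ℓ₁ ℓ₂ ∧ k ∉ Z02 ℓ₁ ℓ₂) ∨
    (k ∉ Z1 ℓ₁ ℓ₂ ∧ k ∈ Z2 ℓ₁ ℓ₂ ∧ k ∉ Z01 ℓ₁ ℓ₂ ∧ k ∉ Z02 ℓ₁ ℓ₂) ∨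
    (k ∉ Z1 ℓ₁ ℓ₂ ∧ k ∉ Z2 ℓ₁ ℓ₂ ∧ k ∈ Z01 ℓ₁ ℓ₂ ∧ k ∉ Z02 ℓ₁ ℓ₂) ∨
    (k ∉ Z1 ℓ₁ ℓ₂ ∧ k ∉ Z2 ℓ₁ ℓ₂ ∧ k ∉ Z01 ℓ₁ ℓ₂ ∧ k ∈ Z02 ℓ₁ ℓ₂) := by
  simp only [mem_Z1, mem_Z2, mem_Z01, mem_Z02, max_lt_iff]
  grind

/-- The contribution of the pair `k` of cells to the expected distortion. -/
noncomputable def regionTerm (μ : Measure ℝ) (f : ℝ → ℝ) (ℓ₁ ℓ₂ : Fin (K + 1) → EReal)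
    (c : Candidates K) (k : Fin K × Fin K) : ℝ :=
  (if k ∈ Z1 ℓ₁ ℓ₂ then
      ((∫ x in cell (ℓ₁ k.1.castSucc) (ℓ₁ k.1.succ), x * f x)
        - c.z1 k * (F μ (ℓ₁ k.1.succ) - F μ (c.z1 k)))
      * (F μ (ℓ₂ k.2.succ) - F μ (ℓ₂ k.2.castSucc)) else 0)
  + (if k ∈ Z2 ℓ₁ ℓ₂ then
      ((∫ x in cell (ℓ₂ k.2.castSucc) (ℓ₂ k.2.succ), x * f x)
        - c.z2 k * (F μ (ℓ₂ k.2.succ) - F μ (c.z2 k)))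
      * (F μ (ℓ₁ k.1.succ) - F μ (ℓ₁ k.1.castSucc)) else 0)
  + (if k ∈ Z01 ℓ₁ ℓ₂ then
      ∫ z in cell (max (ℓ₁ k.1.castSucc) (ℓ₂ k.2.castSucc)) (ℓ₂ k.2.succ),
        z * f z * (2 * F μ z - F μ (ℓ₂ k.2.castSucc) - F μ (ℓ₁ k.1.castSucc)) else 0)
  + (if k ∈ Z01 ℓ₁ ℓ₂ then
      ∫ z in cell (ℓ₂ k.2.succ) (ℓ₁ k.1.succ),
        z * f z * (F μ (ℓ₂ k.2.succ) - F μ (ℓ₂ k.2.castSucc)) else 0)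
  - (if k ∈ Z01 ℓ₁ ℓ₂ then
      max (w11 μ ℓ₁ ℓ₂ k (c.z11 k)) (w12 μ ℓ₁ k (c.z12 k))
        * (F μ (ℓ₁ k.1.succ) - F μ (ℓ₁ k.1.castSucc))
        * (F μ (ℓ₂ k.2.succ) - F μ (ℓ₂ k.2.castSucc)) else 0)
  + (if k ∈ Z02 ℓ₁ ℓ₂ then
      ∫ z in cell (max (ℓ₁ k.1.castSucc) (ℓ₂ k.2.castSucc)) (ℓ₁ k.1.succ),
        z * f z * (2 * F μ z - F μ (ℓ₁ k.1.castSucc) - F μ (ℓ₂ k.2.castSucc)) else 0)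
  + (if k ∈ Z02 ℓ₁ ℓ₂ then
      ∫ z in cell (ℓ₁ k.1.succ) (ℓ₂ k.2.succ),
        z * f z * (F μ (ℓ₁ k.1.succ) - F μ (ℓ₁ k.1.castSucc)) else 0)
  - (if k ∈ Z02 ℓ₁ ℓ₂ then
      max (w11 μ ℓ₁ ℓ₂ k (c.z21 k)) (w22 μ ℓ₂ k (c.z22 k))
        * (F μ (ℓ₁ k.1.succ) - F μ (ℓ₁ k.1.castSucc))
        * (F μ (ℓ₂ k.2.succ) - F μ (ℓ₂ k.2.castSucc)) else 0)

theorem sum_regionTerm (c : Candidates K) :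
    ∑ k, regionTerm μ f ℓ₁ ℓ₂ c k = Dformula μ f ℓ₁ ℓ₂ c := by
  simp only [regionTerm, Dformula, Finset.sum_add_distrib, Finset.sum_sub_distrib,
    Finset.sum_ite_mem, Finset.univ_inter]

/-- The separated regions may contain cells with equal end points. There the only candidate is `a`,
so the bracket vanishes; if `a = ⊤` it vanishes because `z = 0`. -/
theorem IsSource.separated_term_eq_zero {α β : EReal} (h : IsSource μ f α β) {a b : EReal}
    (hab : a = b) (ha : α ≤ a) {z : ℝ} (hz : IsZ1 μ f a b z) :
    (∫ x in cell a b, x * f x) - z * (F μ b - F μ z) = 0 := by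
  subst hab
  have hz' := eq_toReal_of_mem_self hz.1
  have h1 : ∫ x in cell a a, x * f x = 0 :=
    setIntegral_measure_zero _ (cell_self_null a a le_rfl)
  rw [h1]
  rcases eq_or_ne a ⊤ with rfl | ha'
  · simp [hz']
  · have h2 : (z : EReal) = a := by
      rw [hz', EReal.coe_toReal ha' (ne_bot_of_le_ne_bot EReal.zero_ne_bot (h.lower.trans ha))]
    rw [h2]
    ring

theorem IsSource.mem_cell_of_isZ1 {α β : EReal} (h : IsSource μ f α β) {a b : EReal}
    (ha : α ≤ a) (hab : a < b) {z : ℝ} (hz : IsZ1 μ f a b z) : z ∈ cell a b := by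
  rcases hz.1 with hz | hz
  · exact hz.1
  · rw [mem_singleton_iff] at hz
    have h2 : (z : EReal) = a := by
      rw [hz, EReal.coe_toReal hab.ne_top
        (ne_bot_of_le_ne_bot EReal.zero_ne_bot (h.lower.trans ha))]
    exact ⟨h2.ge, h2.le.trans hab.le⟩

/-- At a candidate `F₂ = 1`, and the cell probabilities cancel the denominator of `F₁`. -/
theorem IsSource.separated_term {α β : EReal} (h : IsSource μ f α β) {a₁ b₁ a₂ b₂ : EReal}
    (ha₁ : α ≤ a₁) (ha₂ : α ≤ a₂) (hab₁ : a₁ < b₁) (hab₂ : a₂ < b₂) (hb₁ : b₁ ≤ β)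
    (hba : b₂ ≤ a₁) {z : ℝ} (hz : IsZ1 μ f a₁ b₁ z) :
    wBoth μ a₁ b₁ a₂ b₂ z * ((F μ b₁ - F μ a₁) * (F μ b₂ - F μ a₂)) =
      z * (F μ b₁ - F μ z) * (F μ b₂ - F μ a₂) := by
  have := h.prob
  have := h.null
  have hzc := h.mem_cell_of_isZ1 ha₁ hab₁ hz
  have hpos := h.real_cell_pos ha₁ hab₁ hb₁
  rw [wBoth_of_ge_right (hba.trans hzc.1) (h.pos a₂ b₂ ha₂ hab₂ ((hba.trans hab₁.le).trans hb₁)),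
    wOne, Fcond_eq_div hzc.1 hzc.2]
  field_simp
  ring

theorem IsSource.exists_valid (h : IsSource μ f (ℓ₁ 0) (ℓ₁ (Fin.last K))) {S : Set ℝ}
    (hℓ₁ : IsQuantizer S ℓ₁) (hℓ₂ : IsQuantizer S ℓ₂) :
    ∃ c : Candidates K, c.Valid μ f ℓ₁ ℓ₂ := by
  have h0 : ℓ₂ 0 = ℓ₁ 0 := hℓ₂.first.trans hℓ₁.first.symm
  have hK : ℓ₂ (Fin.last K) = ℓ₁ (Fin.last K) := hℓ₂.last.trans hℓ₁.last.symm
  have ha₁ := hℓ₁.le_castSucc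
  have hb₁ := hℓ₁.succ_le
  have ha₂ : ∀ k : Fin K, ℓ₁ 0 ≤ ℓ₂ k.castSucc := h0 ▸ hℓ₂.le_castSucc
  have hb₂ : ∀ k : Fin K, ℓ₂ k.succ ≤ ℓ₁ (Fin.last K) := hK ▸ hℓ₂.succ_le
  choose z1 hz1 using fun k : Fin K => h.exists_isZ1 (ha₁ k) (hℓ₁.castSucc_le_succ k) (hb₁ k)
  choose z2 hz2 using fun k : Fin K => h.exists_isZ1 (ha₂ k) (hℓ₂.castSucc_le_succ k) (hb₂ k)
  have e11 : ∀ k : Fin K × Fin K, ∃ z, k ∈ Z01 ℓ₁ ℓ₂ →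
      IsZ11 μ (ℓ₁ k.1.castSucc) (ℓ₁ k.1.succ) (ℓ₂ k.2.castSucc) (ℓ₂ k.2.succ) z := fun k => by
    by_cases hk : k ∈ Z01 ℓ₁ ℓ₂
    · have hk' := mem_Z01.1 hk
      obtain ⟨z, hz⟩ := h.exists_isBest_solBoth (ha₁ k.1) (ha₂ k.2) hk'.1 hk'.2 (hb₁ k.1)
      exact ⟨z, fun _ => hz⟩
    · exact ⟨0, fun h => absurd h hk⟩
  have e12 : ∀ k : Fin K × Fin K, ∃ z, k ∈ Z01 ℓ₁ ℓ₂ →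
      IsZ12 μ f (ℓ₁ k.1.castSucc) (ℓ₁ k.1.succ) (ℓ₂ k.2.succ) z := fun k => by
    by_cases hk : k ∈ Z01 ℓ₁ ℓ₂
    · have hk' := mem_Z01.1 hk
      have hlt := (le_max_left _ _).trans_lt hk'.1
      obtain ⟨z, hz⟩ := h.exists_isBest_solOne (ha₁ k.1) hlt.le (hlt.trans_le hk'.2) (hb₁ k.1)
      exact ⟨z, fun _ => hz⟩
    · exact ⟨0, fun h => absurd h hk⟩
  have e21 : ∀ k : Fin K × Fin K, ∃ z, k ∈ Z02 ℓ₁ ℓ₂ →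
      IsZ11 μ (ℓ₂ k.2.castSucc) (ℓ₂ k.2.succ) (ℓ₁ k.1.castSucc) (ℓ₁ k.1.succ) z := fun k => by
    by_cases hk : k ∈ Z02 ℓ₁ ℓ₂
    · have hk' := mem_Z02.1 hk
      rw [max_comm] at hk'
      obtain ⟨z, hz⟩ := h.exists_isBest_solBoth (ha₂ k.2) (ha₁ k.1) hk'.1 hk'.2.le (hb₂ k.2)
      exact ⟨z, fun _ => hz⟩
    · exact ⟨0, fun h => absurd h hk⟩
  have e22 : ∀ k : Fin K × Fin K, ∃ z, k ∈ Z02 ℓ₁ ℓ₂ →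
      IsZ12 μ f (ℓ₂ k.2.castSucc) (ℓ₂ k.2.succ) (ℓ₁ k.1.succ) z := fun k => by
    by_cases hk : k ∈ Z02 ℓ₁ ℓ₂
    · have hk' := mem_Z02.1 hk
      have hlt := (le_max_right _ _).trans_lt hk'.1
      obtain ⟨z, hz⟩ := h.exists_isBest_solOne (ha₂ k.2) hlt.le (hlt.trans hk'.2) (hb₂ k.2)
      exact ⟨z, fun _ => hz⟩
    · exact ⟨0, fun h => absurd h hk⟩
  choose z11 hz11 using e11
  choose z12 hz12 using e12
  choose z21 hz21 using e21
  choose z22 hz22 using e22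
  exact ⟨⟨fun k => z1 k.1, fun k => z2 k.2, z11, z12, z21, z22⟩, fun k _ => hz1 k.1,
    fun k _ => hz2 k.2, hz11, hz12, hz21, hz22⟩

variable {c : Candidates K}

/-- The estimate maximizes the objective `w₁₁`, for every pair of cells of positive probability. -/
theorem IsSource.forall_w11_le_estimate (h : IsSource μ f (ℓ₁ 0) (ℓ₁ (Fin.last K))) {S : Set ℝ}
    (hℓ₁ : IsQuantizer S ℓ₁) (hℓ₂ : IsQuantizer S ℓ₂) (hc : c.Valid μ f ℓ₁ ℓ₂)
    {k : Fin K × Fin K} (h1 : ℓ₁ k.1.castSucc < ℓ₁ k.1.succ)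
    (h2 : ℓ₂ k.2.castSucc < ℓ₂ k.2.succ) (y : ℝ) :
    w11 μ ℓ₁ ℓ₂ k y ≤ w11 μ ℓ₁ ℓ₂ k (c.estimate μ ℓ₁ ℓ₂ k) := by
  have h0 : ℓ₂ 0 = ℓ₁ 0 := hℓ₂.first.trans hℓ₁.first.symm
  have hK : ℓ₂ (Fin.last K) = ℓ₁ (Fin.last K) := hℓ₂.last.trans hℓ₁.last.symm
  have ha₁ := hℓ₁.le_castSucc k.1
  have hb₁ := hℓ₁.succ_le k.1
  have ha₂ := h0 ▸ hℓ₂.le_castSucc k.2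
  have hb₂ := hK ▸ hℓ₂.succ_le k.2
  rw [Candidates.estimate]
  rcases region_cases h1 h2 with ⟨r1, r2, r3, r4⟩ | ⟨r1, r2, r3, r4⟩ | ⟨r1, r2, r3, r4⟩ |
    ⟨r1, r2, r3, r4⟩
  · rw [if_pos r1]
    exact h.forall_wBoth_le_of_isZ1 ha₁ ha₂ h1 h2 hb₁ (mem_Z1.1 r1) (hc.z1 k r1) y
  · rw [if_neg r1, if_pos r2, w11, wBoth_comm]
    exact h.forall_wBoth_le_of_isZ1 ha₂ ha₁ h2 h1 hb₂ (mem_Z2.1 r2) (hc.z2 k r2) y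
  · rw [if_neg r1, if_neg r2, if_pos r3, w11, w12,
      h.wBoth_ite_eq_max ha₂ h2 hb₂ (hc.z12 k r3)]
    exact h.wBoth_le_max ha₁ ha₂ (mem_Z01.1 r3).1 (mem_Z01.1 r3).2 hb₁ (hc.z11 k r3) (hc.z12 k r3) y
  · rw [if_neg r1, if_neg r2, if_neg r3, if_pos r4, w11, w22, wBoth_comm,
      h.wBoth_ite_eq_max ha₁ h1 hb₁ (hc.z22 k r4)]
    exact h.wBoth_le_max ha₂ ha₁ ((max_comm _ _).trans_lt (mem_Z02.1 r4).1) (mem_Z02.1 r4).2.le hb₂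
      (hc.z21 k r4) (hc.z22 k r4) y

theorem IsSource.regionTerm_eq (h : IsSource μ f (ℓ₁ 0) (ℓ₁ (Fin.last K))) {S : Set ℝ}
    (hℓ₁ : IsQuantizer S ℓ₁) (hℓ₂ : IsQuantizer S ℓ₂) (hc : c.Valid μ f ℓ₁ ℓ₂)
    {k : Fin K × Fin K} (h1 : ℓ₁ k.1.castSucc < ℓ₁ k.1.succ)
    (h2 : ℓ₂ k.2.castSucc < ℓ₂ k.2.succ) :
    regionTerm μ f ℓ₁ ℓ₂ c k =
      (∫ x in cell (ℓ₁ k.1.castSucc) (ℓ₁ k.1.succ),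
          x * μ.real (cell (ℓ₂ k.2.castSucc) (ℓ₂ k.2.succ) ∩ Iic x) ∂μ) +
        (∫ x in cell (ℓ₂ k.2.castSucc) (ℓ₂ k.2.succ),
          x * μ.real (cell (ℓ₁ k.1.castSucc) (ℓ₁ k.1.succ) ∩ Iic x) ∂μ) -
        w11 μ ℓ₁ ℓ₂ k (c.estimate μ ℓ₁ ℓ₂ k) *
          ((F μ (ℓ₁ k.1.succ) - F μ (ℓ₁ k.1.castSucc)) *
            (F μ (ℓ₂ k.2.succ) - F μ (ℓ₂ k.2.castSucc))) := by
  have h0 : ℓ₂ 0 = ℓ₁ 0 := hℓ₂.first.trans hℓ₁.first.symm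
  have hK : ℓ₂ (Fin.last K) = ℓ₁ (Fin.last K) := hℓ₂.last.trans hℓ₁.last.symm
  have ha₁ := hℓ₁.le_castSucc k.1
  have hb₁ := hℓ₁.succ_le k.1
  have ha₂ := h0 ▸ hℓ₂.le_castSucc k.2
  have hb₂ := hK ▸ hℓ₂.succ_le k.2
  rw [Candidates.estimate, regionTerm]
  rcases region_cases h1 h2 with ⟨r1, r2, r3, r4⟩ | ⟨r1, r2, r3, r4⟩ | ⟨r1, r2, r3, r4⟩ |
    ⟨r1, r2, r3, r4⟩
  · simp only [if_pos r1, if_neg r2, if_neg r3, if_neg r4]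
    rw [h.integral_max_separated h2.le (mem_Z1.1 r1), w11,
      h.separated_term ha₁ ha₂ h1 h2 hb₁ (mem_Z1.1 r1) (hc.z1 k r1)]
    ring
  · simp only [if_neg r1, if_pos r2, if_neg r3, if_neg r4]
    rw [add_comm (∫ x in cell (ℓ₁ k.1.castSucc) (ℓ₁ k.1.succ), _ ∂μ),
      h.integral_max_separated h1.le (mem_Z2.1 r2), w11, wBoth_comm,
      mul_comm (F μ (ℓ₁ k.1.succ) - _),
      h.separated_term ha₂ ha₁ h2 h1 hb₂ (mem_Z2.1 r2) (hc.z2 k r2)]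
    ring
  · simp only [if_neg r1, if_neg r2, if_pos r3, if_neg r4]
    rw [h.integral_max_overlap (mem_Z01.1 r3).1.le (mem_Z01.1 r3).2, w11, w12,
      h.wBoth_ite_eq_max ha₂ h2 hb₂ (hc.z12 k r3)]
    ring
  · simp only [if_neg r1, if_neg r2, if_neg r3, if_pos r4]
    rw [add_comm (∫ x in cell (ℓ₁ k.1.castSucc) (ℓ₁ k.1.succ), _ ∂μ),
      h.integral_max_overlap ((max_comm _ _).trans_le (mem_Z02.1 r4).1.le) (mem_Z02.1 r4).2.le,
      w11, w22, wBoth_comm, h.wBoth_ite_eq_max ha₁ h1 hb₁ (hc.z22 k r4), max_comm (ℓ₂ k.2.castSucc)]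
    ring

/-- Degenerate pairs are outside both overlap regions. They may belong to `Z1` and `Z2` at once, so
each separated term has to vanish by itself. -/
theorem IsSource.regionTerm_eq_zero (h : IsSource μ f (ℓ₁ 0) (ℓ₁ (Fin.last K))) {S : Set ℝ}
    (hℓ₁ : IsQuantizer S ℓ₁) (hℓ₂ : IsQuantizer S ℓ₂) (hc : c.Valid μ f ℓ₁ ℓ₂)
    {k : Fin K × Fin K}
    (hk : ℓ₁ k.1.castSucc = ℓ₁ k.1.succ ∨ ℓ₂ k.2.castSucc = ℓ₂ k.2.succ) :
    regionTerm μ f ℓ₁ ℓ₂ c k = 0 := by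
  have h0 : ℓ₂ 0 = ℓ₁ 0 := hℓ₂.first.trans hℓ₁.first.symm
  have ha₁ := hℓ₁.le_castSucc k.1
  have ha₂ := h0 ▸ hℓ₂.le_castSucc k.2
  have r3 : k ∉ Z01 ℓ₁ ℓ₂ := by
    simp only [mem_Z01, max_lt_iff]
    grind
  have r4 : k ∉ Z02 ℓ₁ ℓ₂ := by
    simp only [mem_Z02, max_lt_iff]
    grind
  have r1 : k ∈ Z1 ℓ₁ ℓ₂ → ((∫ x in cell (ℓ₁ k.1.castSucc) (ℓ₁ k.1.succ), x * f x)
        - c.z1 k * (F μ (ℓ₁ k.1.succ) - F μ (c.z1 k)))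
      * (F μ (ℓ₂ k.2.succ) - F μ (ℓ₂ k.2.castSucc)) = 0 := by
    intro r1
    rcases hk with hk | hk
    · rw [h.separated_term_eq_zero hk ha₁ (hc.z1 k r1), zero_mul]
    · rw [hk, sub_self, mul_zero]
  have r2 : k ∈ Z2 ℓ₁ ℓ₂ → ((∫ x in cell (ℓ₂ k.2.castSucc) (ℓ₂ k.2.succ), x * f x)
        - c.z2 k * (F μ (ℓ₂ k.2.succ) - F μ (c.z2 k)))
      * (F μ (ℓ₁ k.1.succ) - F μ (ℓ₁ k.1.castSucc)) = 0 := by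
    intro r2
    rcases hk with hk | hk
    · rw [hk, sub_self, mul_zero]
    · rw [h.separated_term_eq_zero hk ha₂ (hc.z2 k r2), zero_mul]
  rw [regionTerm, ite_eq_right_iff.2 r1, ite_eq_right_iff.2 r2]
  simp only [if_neg r3, if_neg r4]
  ring

end Estimator

end MaxHetSQ

theorem mainTheorem10
    {Ω : Type*} [MeasurableSpace Ω] (P : Measure Ω) [IsProbabilityMeasure P]
    -- two independent, identically distributed, non-negative, integrable sources
    (X₁ X₂ : Ω → ℝ) (hX₁ : Measurable X₁) (hX₂ : Measurable X₂)
    (hindep : IndepFun X₁ X₂ P) (hident : IdentDistrib X₁ X₂ P P)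
    (hnonneg : ∀ᵐ ω ∂P, 0 ≤ X₁ ω) (hint : Integrable X₁ P)
    -- their common law, with density `f`, differentiable inside the support
    (μ : Measure ℝ) (hμ : μ = P.map X₁)
    (f : ℝ → ℝ) (hf : Measurable f) (hf0 : ∀ x, 0 ≤ f x)
    (hdens : μ = volume.withDensity fun x => ENNReal.ofReal (f x))
    (hdiff : DifferentiableOn ℝ f (interior μ.support))
    -- the quantizers of the two users and the indices that they report
    {K : ℕ} (ℓ₁ ℓ₂ : Fin (K + 1) → EReal)
    (hℓ₁ : IsQuantizer μ.support ℓ₁) (hℓ₂ : IsQuantizer μ.support ℓ₂)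
    (U₁ U₂ : Ω → Fin K) (hU₁ : Measurable U₁) (hU₂ : Measurable U₂)
    (hXU₁ : ∀ᵐ ω ∂P, X₁ ω ∈ cell (ℓ₁ (U₁ ω).castSucc) (ℓ₁ (U₁ ω).succ))
    (hXU₂ : ∀ᵐ ω ∂P, X₂ ω ∈ cell (ℓ₂ (U₂ ω).castSucc) (ℓ₂ (U₂ ω).succ)) :
    -- Bayes estimates are the maximizers of `z · P(max ≥ z ∣ cells)`
    (∀ k : Fin K × Fin K, P {ω | U₁ ω = k.1 ∧ U₂ ω = k.2} ≠ 0 → ∀ z : ℝ,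
      (IsBayes P X₁ X₂ U₁ U₂ k z ↔
        ∀ y : ℝ,
          gain P X₁ X₂ (cell (ℓ₁ k.1.castSucc) (ℓ₁ k.1.succ))
              (cell (ℓ₂ k.2.castSucc) (ℓ₂ k.2.succ)) y
            ≤ gain P X₁ X₂ (cell (ℓ₁ k.1.castSucc) (ℓ₁ k.1.succ))
              (cell (ℓ₂ k.2.castSucc) (ℓ₂ k.2.succ)) z)) ∧
    -- the values `ẑ₁*, …, ẑ₂₂*` exist
    (∃ c : Candidates K, c.Valid μ f ℓ₁ ℓ₂) ∧
    -- the estimator made of them is the optimal Bayes estimator, and its distortion is as given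
    (∀ c : Candidates K, c.Valid μ f ℓ₁ ℓ₂ →
      (∀ k : Fin K × Fin K, P {ω | U₁ ω = k.1 ∧ U₂ ω = k.2} ≠ 0 →
        IsBayes P X₁ X₂ U₁ U₂ k (c.estimate μ ℓ₁ ℓ₂ k)) ∧
      (∀ g : Fin K × Fin K → ℝ,
        distortion P X₁ X₂ U₁ U₂ (c.estimate μ ℓ₁ ℓ₂) ≤ distortion P X₁ X₂ U₁ U₂ g) ∧
      Integrable (fun ω => dM (X₁ ω) (X₂ ω) (c.estimate μ ℓ₁ ℓ₂ (U₁ ω, U₂ ω))) P ∧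
      distortion P X₁ X₂ U₁ U₂ (c.estimate μ ℓ₁ ℓ₂) = Dformula μ f ℓ₁ ℓ₂ c) ∧
    -- conversely, every Bayes estimate is of this form
    (∀ k : Fin K × Fin K, P {ω | U₁ ω = k.1 ∧ U₂ ω = k.2} ≠ 0 →
      ∀ z : ℝ, IsBayes P X₁ X₂ U₁ U₂ k z →
        (k ∈ Z1 ℓ₁ ℓ₂ → IsZ1 μ f (ℓ₁ k.1.castSucc) (ℓ₁ k.1.succ) z) ∧
        (k ∈ Z2 ℓ₁ ℓ₂ → IsZ1 μ f (ℓ₂ k.2.castSucc) (ℓ₂ k.2.succ) z) ∧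
        (k ∈ Z01 ℓ₁ ℓ₂ →
          IsZ11 μ (ℓ₁ k.1.castSucc) (ℓ₁ k.1.succ) (ℓ₂ k.2.castSucc) (ℓ₂ k.2.succ) z ∨
          IsZ12 μ f (ℓ₁ k.1.castSucc) (ℓ₁ k.1.succ) (ℓ₂ k.2.succ) z) ∧
        (k ∈ Z02 ℓ₁ ℓ₂ →
          IsZ11 μ (ℓ₂ k.2.castSucc) (ℓ₂ k.2.succ) (ℓ₁ k.1.castSucc) (ℓ₁ k.1.succ) z ∨
          IsZ12 μ f (ℓ₂ k.2.castSucc) (ℓ₂ k.2.succ) (ℓ₁ k.1.succ) z)) := by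
  have hprob : IsProbabilityMeasure μ := hμ ▸ Measure.isProbabilityMeasure_map hX₁.aemeasurable
  have hμ₁ : P.map X₁ = μ := hμ.symm
  have hμ₂ : P.map X₂ = μ := by rw [hμ, hident.map_eq]
  have hint₂ : Integrable X₂ P := hident.integrable_iff.1 hint
  have hintμ : Integrable id μ := by
    rw [hμ, integrable_map_measure measurable_id.aestronglyMeasurable hX₁.aemeasurable]
    exact hint
  have hnonnegμ : ∀ᵐ x ∂μ, 0 ≤ x := by
    rw [hμ, ae_map_iff hX₁.aemeasurable measurableSet_Ici]
    exact hnonneg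
  have hsrc := hℓ₁.isSource hf hf0 hdens hdiff hnonnegμ hintμ
  have hnull := hsrc.null
  have h0 : ℓ₂ 0 = ℓ₁ 0 := hℓ₂.first.trans hℓ₁.first.symm
  have hK : ℓ₂ (Fin.last K) = ℓ₁ (Fin.last K) := hℓ₂.last.trans hℓ₁.last.symm
  have ha₁ := hℓ₁.le_castSucc
  have hb₁ := hℓ₁.succ_le
  have ha₂ : ∀ k : Fin K, ℓ₁ 0 ≤ ℓ₂ k.castSucc := h0 ▸ hℓ₂.le_castSucc
  have hb₂ : ∀ k : Fin K, ℓ₂ k.succ ≤ ℓ₁ (Fin.last K) := hK ▸ hℓ₂.succ_le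
  have hE : ∀ k : Fin K × Fin K, {ω | U₁ ω = k.1 ∧ U₂ ω = k.2} =ᵐ[P]
      {ω | X₁ ω ∈ cell (ℓ₁ k.1.castSucc) (ℓ₁ k.1.succ) ∧
        X₂ ω ∈ cell (ℓ₂ k.2.castSucc) (ℓ₂ k.2.succ)} := fun k => by
    filter_upwards [hℓ₁.index_ae_eq hX₁ hμ₁ hXU₁ k.1, hℓ₂.index_ae_eq hX₂ hμ₂ hXU₂ k.2] with ω h1 h2
    exact propext (and_congr h1 h2)
  have hPE : ∀ k : Fin K × Fin K, P.real {ω | U₁ ω = k.1 ∧ U₂ ω = k.2} =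
      μ.real (cell (ℓ₁ k.1.castSucc) (ℓ₁ k.1.succ)) *
        μ.real (cell (ℓ₂ k.2.castSucc) (ℓ₂ k.2.succ)) := fun k => by
    rw [measureReal_congr (hE k), measureReal_mem_mem hX₁ hX₂ hindep hμ₁ hμ₂
      (measurableSet_cell _ _) (measurableSet_cell _ _)]
  -- Cells with equal end points are null, so positive probability forces both cells to be
  -- nondegenerate.
  have hlt : ∀ k : Fin K × Fin K, P {ω | U₁ ω = k.1 ∧ U₂ ω = k.2} ≠ 0 →
      ℓ₁ k.1.castSucc < ℓ₁ k.1.succ ∧ ℓ₂ k.2.castSucc < ℓ₂ k.2.succ := fun k hk => by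
    have h1 : P.real {ω | U₁ ω = k.1 ∧ U₂ ω = k.2} ≠ 0 :=
      (ENNReal.toReal_pos hk (measure_ne_top _ _)).ne'
    rw [hPE] at h1
    constructor <;> by_contra! hle
    · exact left_ne_zero_of_mul h1 (by rw [Measure.real, cell_self_null _ _ hle]; rfl)
    · exact right_ne_zero_of_mul h1 (by rw [Measure.real, cell_self_null _ _ hle]; rfl)
  have hgain : ∀ k : Fin K × Fin K, ℓ₁ k.1.castSucc < ℓ₁ k.1.succ →
      ℓ₂ k.2.castSucc < ℓ₂ k.2.succ → ∀ z, gain P X₁ X₂ (cell (ℓ₁ k.1.castSucc) (ℓ₁ k.1.succ))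
        (cell (ℓ₂ k.2.castSucc) (ℓ₂ k.2.succ)) z = w11 μ ℓ₁ ℓ₂ k z := fun k h1 h2 =>
    gain_eq_wBoth hX₁ hX₂ hindep hμ₁ hμ₂ (hsrc.pos _ _ (ha₁ k.1) h1 (hb₁ k.1))
      (hsrc.pos _ _ (ha₂ k.2) h2 (hb₂ k.2))
  have hbayes_gain : ∀ (k : Fin K × Fin K) (z : ℝ), IsBayes P X₁ X₂ U₁ U₂ k z ↔ ∀ y,
      gain P X₁ X₂ (cell (ℓ₁ k.1.castSucc) (ℓ₁ k.1.succ))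
          (cell (ℓ₂ k.2.castSucc) (ℓ₂ k.2.succ)) y ≤
        gain P X₁ X₂ (cell (ℓ₁ k.1.castSucc) (ℓ₁ k.1.succ))
          (cell (ℓ₂ k.2.castSucc) (ℓ₂ k.2.succ)) z := fun k z =>
    isBayes_iff_gain hX₁ hX₂ hint hint₂ (measurableSet_cell _ _) (measurableSet_cell _ _) (hE k) z
  have hbayes : ∀ k : Fin K × Fin K, P {ω | U₁ ω = k.1 ∧ U₂ ω = k.2} ≠ 0 → ∀ z,
      (IsBayes P X₁ X₂ U₁ U₂ k z ↔ ∀ y, w11 μ ℓ₁ ℓ₂ k y ≤ w11 μ ℓ₁ ℓ₂ k z) := fun k hk z => by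
    simp only [hbayes_gain, hgain k (hlt k hk).1 (hlt k hk).2]
  refine ⟨fun k _ z => hbayes_gain k z, hsrc.exists_valid hℓ₁ hℓ₂, fun c hc => ?_,
    fun k hk z hz => ?_⟩
  · have hopt : ∀ k : Fin K × Fin K, P {ω | U₁ ω = k.1 ∧ U₂ ω = k.2} ≠ 0 →
        IsBayes P X₁ X₂ U₁ U₂ k (c.estimate μ ℓ₁ ℓ₂ k) := fun k hk =>
      (hbayes k hk _).2 (hsrc.forall_w11_le_estimate hℓ₁ hℓ₂ hc (hlt k hk).1 (hlt k hk).2)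
    refine ⟨hopt, fun g => ?_, integrable_dM hX₁ hX₂ hint hint₂ hU₁ hU₂ _, ?_⟩
    -- An estimator may be chosen separately for each pair of indices, so optimality on each pair of
    -- positive probability suffices.
    · rw [distortion_eq_sum hX₁ hX₂ hint hint₂ hU₁ hU₂, distortion_eq_sum hX₁ hX₂ hint hint₂ hU₁ hU₂]
      refine Finset.sum_le_sum fun k _ => ?_
      by_cases hk : P {ω | U₁ ω = k.1 ∧ U₂ ω = k.2} = 0
      · rw [setIntegral_measure_zero _ hk, setIntegral_measure_zero _ hk]
      · have h1 := hopt k hk (g k)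
        rw [condDistortion, condDistortion, integral_cond, integral_cond] at h1
        exact le_of_mul_le_mul_left h1 (inv_pos.2 (ENNReal.toReal_pos hk (measure_ne_top _ _)))
    · rw [distortion_eq_sum hX₁ hX₂ hint hint₂ hU₁ hU₂, ← sum_regionTerm]
      refine Finset.sum_congr rfl fun k _ => ?_
      rcases (hℓ₁.castSucc_le_succ k.1).eq_or_lt with h1 | h1
      · rw [hsrc.regionTerm_eq_zero hℓ₁ hℓ₂ hc (Or.inl h1), setIntegral_measure_zero]
        by_contra hk
        exact (hlt k hk).1.ne h1
      rcases (hℓ₂.castSucc_le_succ k.2).eq_or_lt with h2 | h2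
      · rw [hsrc.regionTerm_eq_zero hℓ₁ hℓ₂ hc (Or.inr h2), setIntegral_measure_zero]
        by_contra hk
        exact (hlt k hk).2.ne h2
      have hpos₁ := hsrc.pos _ _ (ha₁ k.1) h1 (hb₁ k.1)
      have hpos₂ := hsrc.pos _ _ (ha₂ k.2) h2 (hb₂ k.2)
      have hposP := mul_pos hpos₁ hpos₂
      rw [← hPE] at hposP
      -- Multiplying the conditional identity by the probability of the pair gives its contribution
      -- to the unconditional distortion.
      have h3 := condDistortion_eq_sub_gain hX₁ hX₂ hint hint₂ (measurableSet_cell _ _)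
        (measurableSet_cell _ _) (hE k) (c.estimate μ ℓ₁ ℓ₂ k)
      rw [condDistortion, integral_cond, ← measureReal_congr (hE k), hgain k h1 h2,
        setIntegral_max hintμ hX₁ hX₂ hindep hμ₁ hμ₂ (measurableSet_cell _ _)
          (measurableSet_cell _ _), inv_mul_eq_iff_eq_mul₀ hposP.ne', mul_sub,
        mul_inv_cancel_left₀ hposP.ne', hPE, real_cell h1.le, real_cell h2.le] at h3
      rw [h3, hsrc.regionTerm_eq hℓ₁ hℓ₂ hc h1 h2]
      ring
  · obtain ⟨h1, h2⟩ := hlt k hk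
    have hmax := (hbayes k hk z).1 hz
    -- The same maximality with the users exchanged, for the regions of user 2.
    have hmax' := hmax
    rw [w11, wBoth_comm] at hmax'
    refine ⟨fun hr => ?_, fun hr => ?_, fun hr => ?_, fun hr => ?_⟩
    · exact hsrc.isZ1_of_forall_wBoth_le (ha₁ _) (ha₂ _) h1 h2 (hb₁ _) (mem_Z1.1 hr) hmax
    · exact hsrc.isZ1_of_forall_wBoth_le (ha₂ _) (ha₁ _) h2 h1 (hb₂ _) (mem_Z2.1 hr) hmax'
    · exact hsrc.isZ11_or_isZ12_of_forall_wBoth_le (ha₁ _) (ha₂ _) (mem_Z01.1 hr).1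
        (mem_Z01.1 hr).2 (hb₁ _) hmax
    · exact hsrc.isZ11_or_isZ12_of_forall_wBoth_le (ha₂ _) (ha₁ _)
        ((max_comm _ _).trans_lt (mem_Z02.1 hr).1) (mem_Z02.1 hr).2.le (hb₂ _) hmax'
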